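/- Let $U\ge 0$ be an integrable function on $\mathbb R$. For a non-negative locally finite Borel measure $\kappa$ on $\mathbb R$ put $\mathcal J(x)=\int_0^x\kappa(dz)$, that is, $\mathcal J(x)=\kappa((0,x])$ for $x\ge 0$ and $\mathcal J(x)=-\kappa((x,0])$ for $x<0$, and let $\mathcal L^\kappa$ be the integral operator on $L^2(\mathbb R)$ with kernel $$\mathcal L^\kappa(x,y)=\sqrt{U(x)}\,e^{-|\mathcal J(x)-\mathcal J(y)|}\sqrt{U(y)} .$$ Let $\lambda_1(\mathcal L^\kappa)\ge\lambda_2(\mathcal L^\kappa)\ge\dots\ge 0$ be the eigenvalues of this compact positive operator, ordered decreasingly and counted with multiplicity (continued by $0$ if there are only finitely many positive ones). Let $\kappa,\kappa'$ be non-negative locally finite Borel measures on $\mathbb R$ with $\kappa'([s,t])\ge\kappa([s,t])$ for all $s\le t$. Then, for all $n\in\mathbb N$, $$\sum_{i\le n}\lambda_i(\mathcal L^{\kappa'})\le\sum_{i\le n}\lambda_i(\mathcal L^{\kappa}).$$ Moreover, the largest eigenvalue is strictly decreasing in $\kappa$ in the following sense: $\lambda_1(\mathcal L^{\kappa'})<\lambda_1(\mathcal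 L^{\kappa})$ whenever $\kappa'([s,t])>\kappa([s,t])$ for some $s\le t$ with $\int_{-\infty}^sU(x)\,dx>0$ and $\int_t^\infty U(x)\,dx>0$. In particular, this strict inequality holds if $U$ does not vanish almost everywhere and $\kappa'([s,t])>\kappa([s,t])$ for all $s<t$. -/

import Mathlib

open MeasureTheory

noncomputable section

namespace LiebThirring

/-- The Hilbert space `L²(ℝ)` of complex-valued functions, with Lebesgue measure. -/
abbrev L2R : Type := Lp ℂ 2 (volume : Measure ℝ)

/-- `J(x) = ∫₀ˣ κ(dz)`, the oriented integral: `κ((0,x])` for `x ≥ 0` and `-κ((x,0])` for `x ≤ 0`. -/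
def J (κ : Measure ℝ) (x : ℝ) : ℝ := ∫ _z in (0 : ℝ)..x, (1 : ℝ) ∂κ

/-- The kernel `√U(x) · exp(-|J(x) - J(y)|) · √U(y)`. -/
def kernel (U : ℝ → ℝ) (κ : Measure ℝ) (x y : ℝ) : ℝ :=
  √(U x) * Real.exp (-|J κ x - J κ y|) * √(U y)

theorem memLp_sqrt {U : ℝ → ℝ} (hU : Integrable U) :
    MemLp (fun x => √(U x)) 2 (volume : Measure ℝ) := by
  have hm : AEStronglyMeasurable (fun x => √(U x)) (volume : Measure ℝ) :=
    Real.continuous_sqrt.comp_aestronglyMeasurable hU.aestronglyMeasurable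
  rw [memLp_two_iff_integrable_sq hm]
  refine hU.pos_part.congr (Filter.Eventually.of_forall fun x => ?_)
  rcases le_total 0 (U x) with h | h
  · simp [Real.sq_sqrt h, h]
  · simp [Real.sqrt_eq_zero_of_nonpos h, h]

theorem measurable_J (κ : Measure ℝ) [IsLocallyFiniteMeasure κ] : Measurable (J κ) := by
  have hmono : Monotone (J κ) := by
    intro x y hxy
    have hi : ∀ a b : ℝ, IntervalIntegrable (fun _ : ℝ => (1 : ℝ)) κ a b :=
      fun a b => intervalIntegrable_const
    have h := intervalIntegral.integral_interval_sub_left (hi 0 y) (hi 0 x)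
    have h2 : 0 ≤ ∫ _z in x..y, (1 : ℝ) ∂κ :=
      intervalIntegral.integral_nonneg hxy fun _ _ => zero_le_one
    simp only [J]
    linarith
  exact hmono.measurable

theorem norm_kernel_mul_le (U : ℝ → ℝ) (κ : Measure ℝ) (x y : ℝ) (z : ℂ) :
    ‖(kernel U κ x y : ℂ) * z‖ ≤ √(U x) * ‖(√(U y) : ℂ) * z‖ := by
  have he : Real.exp (-|J κ x - J κ y|) ≤ 1 :=
    Real.exp_le_one_iff.2 (neg_nonpos.2 (abs_nonneg _))
  have h0 := Real.sqrt_nonneg (U x)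
  have h1 := Real.sqrt_nonneg (U y)
  rw [norm_mul, norm_mul, Complex.norm_real, Complex.norm_real, Real.norm_eq_abs,
    Real.norm_eq_abs, abs_of_nonneg h1, kernel, abs_of_nonneg (by positivity), ← mul_assoc]
  refine mul_le_mul_of_nonneg_right ?_ (norm_nonneg z)
  exact mul_le_mul_of_nonneg_right (mul_le_of_le_one_right h0 he) h1

theorem integrable_sqrt_mul {U : ℝ → ℝ} (hU : Integrable U) (f : L2R) :
    Integrable (fun y => (√(U y) : ℂ) * f y) :=
  (memLp_sqrt hU).ofReal.integrable_mul (Lp.memLp f)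

theorem aestronglyMeasurable_kernel {U : ℝ → ℝ} (hU : Integrable U) (κ : Measure ℝ)
    [IsLocallyFiniteMeasure κ] (f : L2R) :
    AEStronglyMeasurable (fun p : ℝ × ℝ => (kernel U κ p.1 p.2 : ℂ) * f p.2)
      ((volume : Measure ℝ).prod volume) := by
  have hs := (memLp_sqrt hU).aestronglyMeasurable
  have hJ := measurable_J κ
  have he : AEStronglyMeasurable (fun p : ℝ × ℝ => Real.exp (-|J κ p.1 - J κ p.2|))
      ((volume : Measure ℝ).prod volume) := by
    have h : Measurable (fun p : ℝ × ℝ => J κ p.1 - J κ p.2) :=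
      (hJ.comp measurable_fst).sub (hJ.comp measurable_snd)
    exact ((Real.continuous_exp.comp (continuous_abs.neg)).measurable.comp h).aestronglyMeasurable
  have hk := (hs.comp_fst (ν := (volume : Measure ℝ))).mul he |>.mul
    (hs.comp_snd (μ := (volume : Measure ℝ)))
  exact (Complex.continuous_ofReal.comp_aestronglyMeasurable hk).mul
    ((Lp.aestronglyMeasurable f).comp_snd)

theorem integrable_kernel_mul {U : ℝ → ℝ} (hU : Integrable U) (κ : Measure ℝ)
    [IsLocallyFiniteMeasure κ] (f : L2R) :
    ∀ x : ℝ, Integrable (fun y => (kernel U κ x y : ℂ) * f y) := by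
  intro x
  have hJ := measurable_J κ
  have he : AEStronglyMeasurable (fun y : ℝ => Real.exp (-|J κ x - J κ y|)) volume :=
    ((Real.continuous_exp.comp (continuous_abs.neg)).measurable.comp
      (hJ.const_sub (J κ x))).aestronglyMeasurable
  have hk := (he.const_mul (√(U x))).mul (memLp_sqrt hU).aestronglyMeasurable
  refine ((integrable_sqrt_mul hU f).norm.const_mul (√(U x))).mono'
    ((Complex.continuous_ofReal.comp_aestronglyMeasurable hk).mul
      (Lp.aestronglyMeasurable f)) (Filter.Eventually.of_forall fun y => ?_)
  exact norm_kernel_mul_le U κ x y (f y)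

theorem norm_integral_le {U : ℝ → ℝ} (hU : Integrable U) (κ : Measure ℝ) (f : L2R) (x : ℝ) :
    ‖∫ y, (kernel U κ x y : ℂ) * f y‖ ≤ (∫ y, ‖(√(U y) : ℂ) * f y‖) * ‖√(U x)‖ := by
  rw [Real.norm_of_nonneg (Real.sqrt_nonneg _), mul_comm, ← integral_const_mul]
  exact norm_integral_le_of_norm_le ((integrable_sqrt_mul hU f).norm.const_mul _)
    (Filter.Eventually.of_forall fun y => norm_kernel_mul_le U κ x y (f y))

theorem memLp_integral {U : ℝ → ℝ} (hU : Integrable U) (κ : Measure ℝ)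
    [IsLocallyFiniteMeasure κ] (f : L2R) :
    MemLp (fun x => ∫ y, (kernel U κ x y : ℂ) * f y) 2 (volume : Measure ℝ) :=
  (memLp_sqrt hU).of_le_mul (aestronglyMeasurable_kernel hU κ f).integral_prod_right'
    (Filter.Eventually.of_forall (norm_integral_le hU κ f))

theorem integral_norm_le {U : ℝ → ℝ} (hU : Integrable U) (f : L2R) :
    ∫ y, ‖(√(U y) : ℂ) * f y‖ ≤ ‖(memLp_sqrt hU).toLp‖ * ‖f‖ := by
  let s : Lp ℝ 2 (volume : Measure ℝ) := (memLp_sqrt hU).toLp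
  let g : Lp ℝ 2 (volume : Measure ℝ) := (Lp.memLp f).norm.toLp
  have hg : ‖g‖ = ‖f‖ := by
    rw [Lp.norm_toLp, eLpNorm_norm, Lp.norm_def]
  have h := real_inner_le_norm g s
  rw [L2.inner_def, hg] at h
  rw [mul_comm]
  refine le_trans (le_of_eq (integral_congr_ae ?_)) h
  filter_upwards [(memLp_sqrt hU).coeFn_toLp, (Lp.memLp f).norm.coeFn_toLp] with y h1 h2
  simp only [s, g, h1, h2, norm_mul, Complex.norm_real, Real.norm_eq_abs,
    abs_of_nonneg (Real.sqrt_nonneg _)]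
  simp

/-- The integral operator `L^κ` on `L²(ℝ)`, as a bounded linear operator:
`(L^κ f)(x) = ∫ kernel U κ x y * f y dy`. -/
def opL (U : ℝ → ℝ) (hU : Integrable U) (κ : Measure ℝ) [IsLocallyFiniteMeasure κ] :
    L2R →L[ℂ] L2R :=
  LinearMap.mkContinuous
    { toFun := fun f => (memLp_integral hU κ f).toLp
      map_add' := by
        intro f g
        rw [← MemLp.toLp_add, MemLp.toLp_eq_toLp_iff]
        refine Filter.Eventually.of_forall fun x => ?_
        simp only [Pi.add_apply]
        rw [← integral_add (integrable_kernel_mul hU κ f x) (integrable_kernel_mul hU κ g x)]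
        refine integral_congr_ae ?_
        filter_upwards [Lp.coeFn_add f g] with y hy
        rw [hy, Pi.add_apply, mul_add]
      map_smul' := by
        intro c f
        rw [RingHom.id_apply, ← MemLp.toLp_const_smul, MemLp.toLp_eq_toLp_iff]
        refine Filter.Eventually.of_forall fun x => ?_
        simp only [Pi.smul_apply, smul_eq_mul]
        rw [← integral_const_mul]
        refine integral_congr_ae ?_
        filter_upwards [Lp.coeFn_smul c f] with y hy
        rw [hy, Pi.smul_apply, smul_eq_mul, mul_left_comm] }
    (‖(memLp_sqrt hU).toLp‖ * ‖(memLp_sqrt hU).toLp‖)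
    (by
      intro f
      have h0 : 0 ≤ ‖(memLp_sqrt hU).toLp‖ * ‖f‖ := by positivity
      have h := Lp.norm_le_mul_norm_of_ae_le_mul (f := (memLp_integral hU κ f).toLp)
        (g := (memLp_sqrt hU).toLp) (c := ‖(memLp_sqrt hU).toLp‖ * ‖f‖) (by
          filter_upwards [(memLp_integral hU κ f).coeFn_toLp,
            (memLp_sqrt hU).coeFn_toLp] with x h1 h2
          rw [h1, h2]
          exact (norm_integral_le hU κ f x).trans
            (mul_le_mul_of_nonneg_right (integral_norm_le hU f) (norm_nonneg _)))
      refine h.trans (le_of_eq ?_)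
      ring)

theorem coeFn_opL (U : ℝ → ℝ) (hU : Integrable U) (κ : Measure ℝ) [IsLocallyFiniteMeasure κ]
    (f : L2R) :
    opL U hU κ f =ᵐ[volume] fun x => ∫ y, (kernel U κ x y : ℂ) * f y :=
  (memLp_integral hU κ f).coeFn_toLp

/-- The `(i+1)`-st largest eigenvalue, counted with multiplicity, of a compact positive operator
`T`, continued by `0` if there are at most `i` positive eigenvalues. It is the least `t ≥ 0` such
that at most `i` eigenvalues of `T`, counted with multiplicity, exceed `t`; that number of
eigenvalues is the dimension of the span of the eigenspaces belonging to the eigenvalues `μ > t`. -/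
def orderedEigenvalue {H : Type*} [NormedAddCommGroup H] [InnerProductSpace ℂ H]
    (T : H →L[ℂ] H) (i : ℕ) : ℝ :=
  sInf {t : ℝ | 0 ≤ t ∧
    Module.rank ℂ ↥(⨆ μ ∈ Set.Ioi t, Module.End.eigenspace (T : H →ₗ[ℂ] H) (μ : ℂ)) ≤ i}

end LiebThirring

end

/-! Write `D` for `J κ' - J κ`. The hypothesis makes `J κ`, `J κ'` and `D` all monotone, so `|J κ' x
- J κ' y|` is the sum of `|J κ x - J κ y|` and `|D x - D y|`, and the new kernel is the old one
times `exp (-|D x - D y|)` (`kernel_eq_mul`). Since `exp (-|d|)` is the characteristic function of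
the Cauchy distribution (`integral_exp_cauchyMeasure`), the new operator is an average, over a
probability measure in `p`, of conjugates of the old one by the unitary multiplications `exp (-i p
D)` (`inner_opL_eq_integral`). By Ky Fan, the sum of the `n` largest eigenvalues bounds the trace of
the form over any orthonormal `n`-system (`sum_re_inner_le_sum_orderedEigenvalue`) and is
approximated by such traces over at most `n` vectors
(`exists_orthonormal_sum_orderedEigenvalue_le`). Unitary conjugation preserves orthonormality, so
averaging cannot increase the sum. The same Cauchy average writes the operator as an integral of
rank-one operators, which gives compactness. For strictness, take a top eigenvector `f` of the new
operator. It is nonzero almost everywhere on `{U > 0}` (`exists_groundState`). The old kernel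
dominates the new one, strictly on a set of positive measure where `|f|` is positive, so the form of
the old operator at `|f|` exceeds the new top eigenvalue. -/

noncomputable section

namespace LiebThirring

/-! ### Spectral theory of compact symmetric operators above a threshold -/

section TopEigenspace

variable {H : Type*} [NormedAddCommGroup H] [InnerProductSpace ℂ H]

/-- The span of the eigenspaces of `T` belonging to the eigenvalues larger than `t`. -/
def topEigenspace (T : H →L[ℂ] H) (t : ℝ) : Submodule ℂ H :=
  ⨆ μ ∈ Set.Ioi t, Module.End.eigenspace (T : H →ₗ[ℂ] H) (μ : ℂ)

theorem mem_topEigenspace {T : H →L[ℂ] H} {t μ : ℝ} (h : t < μ) {x : H}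
    (hx : T x = (μ : ℂ) • x) : x ∈ topEigenspace T t :=
  Submodule.mem_iSup_of_mem μ (Submodule.mem_iSup_of_mem h (Module.End.mem_eigenspace_iff.2 hx))

theorem topEigenspace_le {T : H →L[ℂ] H} {t : ℝ} {p : Submodule ℂ H}
    (h : ∀ μ : ℝ, t < μ → ∀ x, T x = (μ : ℂ) • x → x ∈ p) : topEigenspace T t ≤ p :=
  iSup₂_le fun μ hμ x hx => h μ hμ x (Module.End.mem_eigenspace_iff.1 hx)

theorem apply_mem_topEigenspace {T : H →L[ℂ] H} {t : ℝ} {x : H} (hx : x ∈ topEigenspace T t) :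
    T x ∈ topEigenspace T t := by
  have h : topEigenspace T t ≤ (topEigenspace T t).comap (T : H →ₗ[ℂ] H) :=
    topEigenspace_le fun μ hμ x hx => by
      rw [Submodule.mem_comap, ContinuousLinearMap.coe_coe, hx]
      exact Submodule.smul_mem _ _ (mem_topEigenspace hμ hx)
  exact h hx

theorem inner_eq_zero_of_eigenvector {T : H →L[ℂ] H} (hs : T.IsSymmetric) {μ ν : ℝ} (hne : μ ≠ ν)
    {x y : H} (hx : T x = (μ : ℂ) • x) (hy : T y = (ν : ℂ) • y) : inner ℂ x y = 0 := by
  have h : inner ℂ (T x) y = inner ℂ x (T y) := hs x y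
  rw [hx, hy, inner_smul_left, inner_smul_right, Complex.conj_ofReal] at h
  have h' : ((μ : ℂ) - ν) * inner ℂ x y = 0 := by rw [sub_mul, h, sub_self]
  rcases mul_eq_zero.1 h' with h | h
  · exact absurd (Complex.ofReal_injective (sub_eq_zero.1 h)) hne
  · exact h

theorem mem_orthogonal_topEigenspace {T : H →L[ℂ] H} (hs : T.IsSymmetric) {t μ : ℝ} (h : μ ≤ t)
    {x : H} (hx : T x = (μ : ℂ) • x) : x ∈ (topEigenspace T t)ᗮ := by
  have h' : topEigenspace T t ≤ (ℂ ∙ x)ᗮ := topEigenspace_le fun ν hν y hy => by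
    rw [Submodule.mem_orthogonal_singleton_iff_inner_right]
    exact inner_eq_zero_of_eigenvector hs (by linarith) hx hy
  rw [Submodule.mem_orthogonal]
  intro u hu
  exact Submodule.mem_orthogonal_singleton_iff_inner_left.1 (h' hu)

theorem apply_mem_orthogonal_topEigenspace {T : H →L[ℂ] H} (hs : T.IsSymmetric) {t : ℝ} {x : H}
    (hx : x ∈ (topEigenspace T t)ᗮ) : T x ∈ (topEigenspace T t)ᗮ := by
  rw [Submodule.mem_orthogonal] at hx ⊢
  intro u hu
  rw [← hs.apply_clm u x]
  exact hx _ (apply_mem_topEigenspace hu)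

/-- Pythagoras over the mutually orthogonal eigenspaces. This lower bound on `T` is what forces
finite dimension below. -/
theorem mul_norm_le_of_mem_topEigenspace {T : H →L[ℂ] H} (hs : T.IsSymmetric) {t : ℝ} (ht : 0 ≤ t)
    {x : H} (hx : x ∈ topEigenspace T t) : t * ‖x‖ ≤ ‖T x‖ := by
  classical
  rw [topEigenspace, iSup_subtype', Submodule.mem_iSup_iff_exists_finsupp] at hx
  obtain ⟨f, hf, rfl⟩ := hx
  have hf' : ∀ i, T (f i) = ((i : ℝ) : ℂ) • f i := fun i => Module.End.mem_eigenspace_iff.1 (hf i)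
  have key : ∀ g : Set.Ioi t → H, (∀ i, T (g i) = ((i : ℝ) : ℂ) • g i) →
      ‖∑ i ∈ f.support, g i‖ ^ 2 = ∑ i ∈ f.support, ‖g i‖ ^ 2 := by
    intro g hg
    have h := hs.orthogonalFamily_eigenspaces.comp
      (γ := Set.Ioi t) (f := fun i => ((i : ℝ) : ℂ)) (by
        intro i j hij
        exact Subtype.ext (Complex.ofReal_injective hij))
    exact h.norm_sum (fun i => ⟨g i, Module.End.mem_eigenspace_iff.2 (hg i)⟩) f.support
  rw [Finsupp.sum, map_sum]
  refine le_of_sq_le_sq ?_ (norm_nonneg _)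
  rw [mul_pow, key _ hf', key _ fun i => by rw [hf', map_smul, hf'], Finset.mul_sum]
  refine Finset.sum_le_sum fun i _ => ?_
  rw [hf', norm_smul, Complex.norm_real, mul_pow, Real.norm_eq_abs, sq_abs]
  have := (Set.mem_Ioi.1 i.2).le
  gcongr

variable [CompleteSpace H]

/-- Nonzero spectrum of a compact operator consists of eigenvalues, so the spectrum lies below `t`.
The condition `0 ≤ t` covers the point `0`, which may be spectral without being an eigenvalue. -/
theorem re_inner_le_of_forall_eigenvalue_le {S : H →L[ℂ] H} (hc : IsCompactOperator S)
    (hs : S.IsSymmetric) {t : ℝ} (ht : 0 ≤ t)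
    (h : ∀ μ : ℝ, Module.End.HasEigenvalue (S : H →ₗ[ℂ] H) (μ : ℂ) → μ ≤ t) (x : H) :
    (inner ℂ x (S x)).re ≤ t * ‖x‖ ^ 2 := by
  have hsa : IsSelfAdjoint S := hs.isSelfAdjoint
  have hle : S ≤ algebraMap ℝ _ t := by
    rw [le_algebraMap_iff_spectrum_le]
    intro μ hμ
    by_contra! hlt
    have hμ0 : (μ : ℂ) ≠ 0 := by
      rw [Complex.ofReal_ne_zero]; linarith
    exact absurd (h μ ((hc.hasEigenvalue_iff_mem_spectrum hμ0).2
      ((spectrum.algebraMap_mem_iff ℂ).2 hμ))) (not_le.2 hlt)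
  have h := ((ContinuousLinearMap.le_def _ _).1 hle).re_inner_nonneg_right x
  have e1 : (algebraMap ℝ (H →L[ℂ] H) t) x = (t : ℂ) • x := by
    rw [Algebra.algebraMap_eq_smul_one]
    simp
  rw [sub_apply, e1, inner_sub_right, inner_smul_right, inner_self_eq_norm_sq_to_K] at h
  norm_cast at h
  simp only [map_sub, RCLike.re_to_complex, Complex.coe_algebraMap] at h
  rw [← Complex.ofReal_mul, Complex.ofReal_re] at h
  linarith

/-- The complement is invariant, and an eigenvector there with eigenvalue above `t` would also lie
in `topEigenspace T t`, hence vanish. -/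
theorem re_inner_le_of_mem_orthogonal {T : H →L[ℂ] H} (hc : IsCompactOperator T)
    (hs : T.IsSymmetric) {t : ℝ} (ht : 0 ≤ t) {x : H} (hx : x ∈ (topEigenspace T t)ᗮ) :
    (inner ℂ x (T x)).re ≤ t * ‖x‖ ^ 2 := by
  have hinv : ∀ y ∈ (topEigenspace T t)ᗮ, T y ∈ (topEigenspace T t)ᗮ :=
    fun y hy => apply_mem_orthogonal_topEigenspace hs hy
  let S : (topEigenspace T t)ᗮ →L[ℂ] (topEigenspace T t)ᗮ := T.restrict hinv
  have hSc : IsCompactOperator S := hc.restrict' hinv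
  have hSs : S.IsSymmetric := hs.restrict_invariant hinv
  refine re_inner_le_of_forall_eigenvalue_le hSc hSs ht (fun μ hμ => ?_) ⟨x, hx⟩
  by_contra! hlt
  obtain ⟨v, hv, hv0⟩ := hμ.exists_hasEigenvector
  have hv' : T v = (μ : ℂ) • (v : H) :=
    congrArg Subtype.val (Module.End.mem_eigenspace_iff.1 hv)
  apply hv0
  ext
  exact (Submodule.mem_orthogonal' _ _).1 v.2 _ (mem_topEigenspace hlt hv') |>
    inner_self_eq_zero.1

/-- On the closure `T` is both compact and bounded below, so the closed unit ball is compact and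
Riesz's theorem applies. -/
theorem finiteDimensional_topEigenspace {T : H →L[ℂ] H} (hc : IsCompactOperator T)
    (hs : T.IsSymmetric) {t : ℝ} (ht : 0 < t) : FiniteDimensional ℂ (topEigenspace T t) := by
  let Y := (topEigenspace T t).topologicalClosure
  have hY : ∀ y ∈ Y, t * ‖y‖ ≤ ‖T y‖ := by
    intro y hy
    have hcl : IsClosed {y : H | t * ‖y‖ ≤ ‖T y‖} :=
      isClosed_le (by fun_prop) (by fun_prop)
    exact closure_minimal (fun x hx => mul_norm_le_of_mem_topEigenspace hs ht.le hx) hcl hy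
  let f : Y →L[ℂ] H := T.comp Y.subtypeL
  have : CompleteSpace Y := (topEigenspace T t).isClosed_topologicalClosure.completeSpace_coe
  have hfa : ∃ K, AntilipschitzWith K f := by
    refine ⟨⟨t⁻¹, by positivity⟩, AddMonoidHomClass.antilipschitz_of_bound f fun x => ?_⟩
    change ‖x‖ ≤ t⁻¹ * ‖T x‖
    rw [le_inv_mul_iff₀ ht]
    exact hY x x.2
  obtain ⟨K, hfa⟩ := hfa
  have hemb := hfa.isClosedEmbedding f.uniformContinuous
  have hfc : IsCompactOperator f := hc.comp_clm Y.subtypeL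
  have hcomp : IsCompact (Metric.closedBall (0 : Y) 1) := by
    refine (hemb.isCompact_preimage
      (hfc.isCompact_closure_image_closedBall (f := (f : Y →ₗ[ℂ] H)) 1)).of_isClosed_subset
      Metric.isClosed_closedBall fun x hx => subset_closure ⟨x, hx, rfl⟩
  have := FiniteDimensional.of_isCompact_closedBall ℂ zero_lt_one hcomp
  exact Submodule.finiteDimensional_of_le (topEigenspace T t).le_topologicalClosure

/-- An orthonormal basis of `topEigenspace T t` consisting of eigenvectors of `T`, ordered by
decreasing eigenvalues. -/
structure TopEigenbasis (T : H →L[ℂ] H) (t : ℝ) where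
  /-- The number of eigenvalues above `t`. -/
  d : ℕ
  /-- The eigenvectors. -/
  e : Fin d → H
  /-- The eigenvalues. -/
  μ : Fin d → ℝ
  orthonormal : Orthonormal ℂ e
  antitone : Antitone μ
  apply_e : ∀ j, T (e j) = (μ j : ℂ) • e j
  lt_μ : ∀ j, t < μ j
  span_e : Submodule.span ℂ (Set.range e) = topEigenspace T t

theorem nonempty_topEigenbasis {T : H →L[ℂ] H} (hc : IsCompactOperator T)
    (hs : T.IsSymmetric) {t : ℝ} (ht : 0 < t) : Nonempty (TopEigenbasis T t) := by
  have hfd := finiteDimensional_topEigenspace hc hs ht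
  have hinv : ∀ y ∈ topEigenspace T t, (T : H →ₗ[ℂ] H) y ∈ topEigenspace T t :=
    fun y hy => apply_mem_topEigenspace hy
  have hR := hs.restrict_invariant hinv
  let b := hR.eigenvectorBasis rfl
  have hb : ∀ j, T (b j) = (hR.eigenvalues rfl j : ℂ) • (b j : H) := fun j =>
    congrArg Subtype.val (hR.apply_eigenvectorBasis rfl j)
  have hbo : Orthonormal ℂ fun j => (b j : H) :=
    b.orthonormal.comp_linearIsometry (topEigenspace T t).subtypeₗᵢ
  refine ⟨⟨_, fun j => (b j : H), hR.eigenvalues rfl, hbo, hR.eigenvalues_antitone rfl, hb,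
    ?_, ?_⟩⟩
  · intro j
    -- An eigenvalue at most `t` would make the vector orthogonal to the space containing it.
    by_contra! hle
    have h := (Submodule.mem_orthogonal' _ _).1 (mem_orthogonal_topEigenspace hs hle (hb j)) _
      (b j).2
    exact hbo.ne_zero j (inner_self_eq_zero.1 h)
  · have h := b.toBasis.span_eq
    rw [b.coe_toBasis] at h
    have h2 := congrArg (Submodule.map (topEigenspace T t).subtype) h
    rw [Submodule.map_span, Submodule.map_subtype_top, ← Set.range_comp] at h2
    exact h2

end TopEigenspace

/-! ### Ordered eigenvalues and Ky Fan's variational principle -/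

section KyFan

variable {H : Type*} [NormedAddCommGroup H] [InnerProductSpace ℂ H]

theorem orderedEigenvalue_nonneg (T : H →L[ℂ] H) (i : ℕ) : 0 ≤ orderedEigenvalue T i :=
  Real.sInf_nonneg fun _ ht => ht.1

theorem orderedEigenvalue_le {T : H →L[ℂ] H} {i : ℕ} {t : ℝ} (ht : 0 ≤ t)
    (h : Module.rank ℂ (topEigenspace T t) ≤ i) : orderedEigenvalue T i ≤ t :=
  csInf_le ⟨0, fun _ hs => hs.1⟩ ⟨ht, h⟩

theorem topEigenspace_norm (T : H →L[ℂ] H) : topEigenspace T ‖T‖ = ⊥ := by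
  rw [eq_bot_iff]
  refine topEigenspace_le fun μ hμ x hx => ?_
  rw [Submodule.mem_bot]
  by_contra hx0
  have h := T.le_opNorm x
  rw [hx, norm_smul, Complex.norm_real] at h
  have h' := le_of_mul_le_mul_right h (norm_pos_iff.2 hx0)
  linarith [le_abs_self μ, Real.norm_eq_abs μ]

/-- The threshold `‖T‖` shows that the infimum is over a nonempty set, so it is not the default
value `0`. -/
theorem le_orderedEigenvalue {T : H →L[ℂ] H} {i : ℕ} {c : ℝ}
    (h : ∀ t, 0 ≤ t → Module.rank ℂ (topEigenspace T t) ≤ i → c ≤ t) :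
    c ≤ orderedEigenvalue T i := by
  refine le_csInf ⟨‖T‖, norm_nonneg T, ?_⟩ fun t ht => h t ht.1 ht.2
  change Module.rank ℂ (topEigenspace T ‖T‖) ≤ i
  rw [topEigenspace_norm, rank_bot]
  exact zero_le

theorem orderedEigenvalue_antitone (T : H →L[ℂ] H) : Antitone (orderedEigenvalue T) :=
  fun _ _ hij => le_orderedEigenvalue fun _ ht h =>
    orderedEigenvalue_le ht (h.trans (Nat.cast_le.2 hij))

namespace TopEigenbasis

variable {T : H →L[ℂ] H} {t : ℝ} (B : TopEigenbasis T t)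
include B

theorem e_mem {s : ℝ} {j : Fin B.d} (h : s < B.μ j) : B.e j ∈ topEigenspace T s :=
  mem_topEigenspace h (B.apply_e j)

theorem re_inner_e (j : Fin B.d) : (inner ℂ (B.e j) (T (B.e j))).re = B.μ j := by
  rw [B.apply_e, inner_smul_right, inner_self_eq_norm_sq_to_K, B.orthonormal.1 j]
  simp

theorem sum_inner_e {x : H} (hx : x ∈ topEigenspace T t) :
    ∑ j, inner ℂ (B.e j) x • B.e j = x := by
  rw [← B.span_e, Submodule.mem_span_range_iff_exists_fun] at hx
  obtain ⟨c, rfl⟩ := hx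
  exact Finset.sum_congr rfl fun j _ => by rw [B.orthonormal.inner_right_fintype]

/-- Below `B.μ j` the `j + 1` independent vectors `e 0, …, e j` all survive, one more than the rank
allows. -/
theorem μ_le_orderedEigenvalue (j : Fin B.d) : B.μ j ≤ orderedEigenvalue T j := by
  refine le_orderedEigenvalue fun s _ hr => ?_
  by_contra! hlt
  have hle : (j : ℕ) + 1 ≤ B.d := j.2
  let v : Fin (j + 1) → topEigenspace T s := fun i =>
    ⟨B.e (Fin.castLE hle i), B.e_mem (hlt.trans_le (B.antitone (by
      rw [Fin.le_def]
      exact Nat.lt_succ_iff.1 i.2)))⟩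
  have hv : LinearIndependent ℂ v := by
    refine LinearIndependent.of_comp (topEigenspace T s).subtype ?_
    exact B.orthonormal.linearIndependent.comp _ (Fin.castLE_injective hle)
  have h := hv.cardinal_lift_le_rank.trans (Cardinal.lift_le.2 hr)
  rw [Cardinal.mk_fin, Cardinal.lift_natCast, Cardinal.lift_natCast, Nat.cast_le] at h
  omega

/-- An eigenvector with eigenvalue above `B.μ j` is orthogonal to every `e i` with `i ≥ j`, so at
most `j` vectors span. -/
theorem orderedEigenvalue_le_μ (ht : 0 ≤ t) (hs : T.IsSymmetric) (j : Fin B.d) :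
    orderedEigenvalue T j ≤ B.μ j := by
  classical
  have htj := B.lt_μ j
  refine orderedEigenvalue_le (by linarith) ?_
  have hle : topEigenspace T (B.μ j) ≤
      Submodule.span ℂ (((Finset.univ.filter (· < j)).image B.e : Finset H) : Set H) := by
    refine topEigenspace_le fun ν hν x hx => ?_
    rw [← B.sum_inner_e (mem_topEigenspace (htj.trans hν) hx)]
    refine Submodule.sum_mem _ fun i _ => ?_
    rcases lt_or_ge i j with h | h
    · refine Submodule.smul_mem _ _ (Submodule.subset_span ?_)
      rw [Finset.mem_coe]
      exact Finset.mem_image_of_mem _ (Finset.mem_filter.2 ⟨Finset.mem_univ i, h⟩)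
    · have h' := B.antitone h
      rw [inner_eq_zero_of_eigenvector hs (by linarith) (B.apply_e i) hx, zero_smul]
      exact Submodule.zero_mem _
  refine (Submodule.rank_mono hle).trans ((rank_span_finset_le _).trans ?_)
  rw [Nat.cast_le]
  refine Finset.card_image_le.trans ?_
  rw [Finset.filter_gt_eq_Iio, Fin.card_Iio]

theorem orderedEigenvalue_eq (ht : 0 ≤ t) (hs : T.IsSymmetric) (j : Fin B.d) :
    orderedEigenvalue T j = B.μ j :=
  (B.orderedEigenvalue_le_μ ht hs j).antisymm (B.μ_le_orderedEigenvalue j)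

theorem orderedEigenvalue_le_of_le (ht : 0 ≤ t) {i : ℕ} (hi : B.d ≤ i) :
    orderedEigenvalue T i ≤ t := by
  classical
  refine orderedEigenvalue_le ht ?_
  rw [← B.span_e, ← Set.image_univ, ← Finset.coe_univ, ← Finset.coe_image]
  refine (rank_span_finset_le _).trans (Nat.cast_le.2 (Finset.card_image_le.trans ?_))
  rwa [Finset.card_univ, Fintype.card_fin]

/-- Split `x` into its projection `p` on the top eigenspace and the rest; the cross terms vanish.
The weights `B.μ j - t` are positive, which lets Bessel's inequality be used on them later. -/
theorem re_inner_le [CompleteSpace H] (hc : IsCompactOperator T) (hs : T.IsSymmetric) (ht : 0 ≤ t)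
    (x : H) : (inner ℂ x (T x)).re ≤
      t * ‖x‖ ^ 2 + ∑ j, (B.μ j - t) * ‖inner ℂ (B.e j) x‖ ^ 2 := by
  set c : Fin B.d → ℂ := fun j => inner ℂ (B.e j) x with hcdef
  set p : H := ∑ j, c j • B.e j with hp
  have hpV : p ∈ topEigenspace T t :=
    Submodule.sum_mem _ fun j _ => Submodule.smul_mem _ _ (B.e_mem (B.lt_μ j))
  have hTp : T p = ∑ j, (c j * (B.μ j : ℂ)) • B.e j := by
    rw [hp, map_sum]
    exact Finset.sum_congr rfl fun j _ => by rw [map_smul, B.apply_e, smul_smul]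
  have hq : x - p ∈ (topEigenspace T t)ᗮ := by
    rw [Submodule.mem_orthogonal]
    intro u hu
    rw [← B.sum_inner_e hu, sum_inner]
    refine Finset.sum_eq_zero fun j _ => ?_
    rw [inner_smul_left, inner_sub_right, hp, B.orthonormal.inner_right_fintype, sub_self, mul_zero]
  have hpp : ‖p‖ ^ 2 = ∑ j, ‖c j‖ ^ 2 := by
    have h := B.orthonormal.inner_sum c c Finset.univ
    rw [← hp, inner_self_eq_norm_sq_to_K] at h
    apply Complex.ofReal_injective
    push_cast
    exact h.trans (Finset.sum_congr rfl fun j _ => Complex.conj_mul' (c j))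
  have hpTp : (inner ℂ p (T p)).re = ∑ j, B.μ j * ‖c j‖ ^ 2 := by
    rw [hTp, hp, B.orthonormal.inner_sum, Complex.re_sum]
    refine Finset.sum_congr rfl fun j _ => ?_
    rw [← mul_assoc, Complex.conj_mul', ← Complex.ofReal_pow, ← Complex.ofReal_mul,
      Complex.ofReal_re, mul_comm]
  have hqT := re_inner_le_of_mem_orthogonal hc hs ht hq
  have h1 : inner ℂ p (T (x - p)) = 0 :=
    (Submodule.mem_orthogonal _ _).1 (apply_mem_orthogonal_topEigenspace hs hq) _ hpV
  have h2 : inner ℂ (x - p) (T p) = 0 :=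
    (Submodule.mem_orthogonal' _ _).1 hq _ (apply_mem_topEigenspace hpV)
  have hxx : ‖x‖ ^ 2 = ‖p‖ ^ 2 + ‖x - p‖ ^ 2 := by
    have h := norm_add_sq_eq_norm_sq_add_norm_sq_of_inner_eq_zero p (x - p)
      ((Submodule.mem_orthogonal _ _).1 hq _ hpV)
    rw [add_sub_cancel] at h
    simpa only [sq] using h
  have hform : inner ℂ x (T x) = inner ℂ p (T p) + inner ℂ (x - p) (T (x - p)) := by
    conv_lhs => rw [← add_sub_cancel p x, map_add, inner_add_left, inner_add_right,
      inner_add_right, h1, h2]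
    ring
  rw [hform, Complex.add_re, hpTp, hxx, hpp]
  have hsum : ∑ j, (B.μ j - t) * ‖c j‖ ^ 2 = ∑ j, B.μ j * ‖c j‖ ^ 2 - t * ∑ j, ‖c j‖ ^ 2 := by
    rw [Finset.mul_sum, ← Finset.sum_sub_distrib]
    exact Finset.sum_congr rfl fun j _ => by ring
  rw [hsum]
  linarith

end TopEigenbasis

variable [CompleteSpace H]

/-- **Ky Fan's inequality** for compact symmetric operators. -/
theorem sum_re_inner_le_sum_orderedEigenvalue {T : H →L[ℂ] H} (hc : IsCompactOperator T)
    (hs : T.IsSymmetric) {n : ℕ} {x : Fin n → H} (hx : Orthonormal ℂ x) :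
    ∑ i, (inner ℂ (x i) (T (x i))).re ≤ ∑ i ∈ Finset.range n, orderedEigenvalue T i := by
  have key : ∀ ε : ℝ, 0 < ε → ∑ i, (inner ℂ (x i) (T (x i))).re ≤
      ∑ i ∈ Finset.range n, orderedEigenvalue T i + n * ε := by
    intro ε hε
    -- Indices start at `0`, so `n - 1` is the `n`-th largest eigenvalue and at most `n` eigenvalues
    -- exceed `t`; for `n = 0` the truncated index is `0` and none do. The `ε` keeps `t` positive.
    set t := max (orderedEigenvalue T (n - 1)) ε with ht
    have ht0 : 0 < t := lt_max_of_lt_right hε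
    obtain ⟨B⟩ := nonempty_topEigenbasis hc hs ht0
    have hdn : B.d ≤ n := by
      by_contra! h
      have h1 := B.orderedEigenvalue_eq ht0.le hs ⟨n - 1, by omega⟩
      have h2 := B.lt_μ ⟨n - 1, by omega⟩
      rw [← h1] at h2
      exact absurd (le_max_left _ _) (not_le.2 h2)
    have h1 : ∑ i, (inner ℂ (x i) (T (x i))).re ≤ n * t + ∑ j, (B.μ j - t) := by
      calc ∑ i, (inner ℂ (x i) (T (x i))).re
          ≤ ∑ i, (t * ‖x i‖ ^ 2 + ∑ j, (B.μ j - t) * ‖inner ℂ (B.e j) (x i)‖ ^ 2) :=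
            Finset.sum_le_sum fun i _ => B.re_inner_le hc hs ht0.le (x i)
        _ = n * t + ∑ j, (B.μ j - t) * ∑ i, ‖inner ℂ (x i) (B.e j)‖ ^ 2 := by
            rw [Finset.sum_add_distrib, Finset.sum_comm]
            simp only [hx.1, one_pow, mul_one, Finset.sum_const, Finset.card_univ,
              Fintype.card_fin, nsmul_eq_mul, Finset.mul_sum, norm_inner_symm]
        _ ≤ n * t + ∑ j, (B.μ j - t) := by
            gcongr with j
            -- Bessel's inequality for the system `x`, applied to the unit vector `B.e j`.
            refine mul_le_of_le_one_right (sub_nonneg.2 (B.lt_μ j).le) ?_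
            have h := hx.sum_inner_products_le (B.e j) (s := Finset.univ)
            rwa [B.orthonormal.1 j, one_pow] at h
    have h2 : ∑ j, (B.μ j - t) = ∑ i ∈ Finset.range B.d, (orderedEigenvalue T i - t) := by
      rw [← Fin.sum_univ_eq_sum_range]
      exact Finset.sum_congr rfl fun j _ => by rw [B.orderedEigenvalue_eq ht0.le hs]
    have h3 : ∑ i ∈ Finset.range B.d, (orderedEigenvalue T i - t) ≤
        ∑ i ∈ Finset.range n, (orderedEigenvalue T i - t + ε) := by
      refine (Finset.sum_le_sum fun i _ => (le_add_of_nonneg_right hε.le)).trans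
        (Finset.sum_le_sum_of_subset_of_nonneg (Finset.range_subset_range.2 hdn) fun i hi _ => ?_)
      have h := orderedEigenvalue_antitone T (Nat.le_sub_one_of_lt (Finset.mem_range.1 hi))
      have h' := orderedEigenvalue_nonneg T i
      have : t ≤ orderedEigenvalue T i + ε := max_le (by linarith) (by linarith)
      linarith
    have h4 := h2.le.trans h3
    rw [Finset.sum_add_distrib, Finset.sum_sub_distrib (s := Finset.range n)] at h4
    simp only [Finset.sum_const, Finset.card_range, nsmul_eq_mul] at h4
    linarith
  refine le_of_forall_pos_le_add fun ε hε => ?_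
  refine (key (ε / (n + 1)) (by positivity)).trans ?_
  gcongr
  rw [mul_div_assoc', div_le_iff₀ (by positivity)]
  nlinarith

theorem re_inner_le_orderedEigenvalue_zero {T : H →L[ℂ] H} (hc : IsCompactOperator T)
    (hs : T.IsSymmetric) (x : H) :
    (inner ℂ x (T x)).re ≤ orderedEigenvalue T 0 * ‖x‖ ^ 2 := by
  rcases eq_or_ne x 0 with rfl | hx
  · simp
  have hn : ‖x‖ ≠ 0 := norm_ne_zero_iff.2 hx
  have ho : Orthonormal ℂ fun _ : Fin 1 => ((‖x‖⁻¹ : ℝ) : ℂ) • x := by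
    refine ⟨fun _ => ?_, fun i j hij => absurd (Subsingleton.elim i j) hij⟩
    rw [norm_smul, Complex.norm_real, norm_inv, norm_norm, inv_mul_cancel₀ hn]
  have h := sum_re_inner_le_sum_orderedEigenvalue hc hs ho
  simp only [Finset.univ_unique, Finset.sum_singleton, Finset.range_one, map_smul,
    inner_smul_left, inner_smul_right, Complex.conj_ofReal] at h
  rw [← mul_assoc, ← Complex.ofReal_mul, Complex.re_ofReal_mul] at h
  have hp : 0 < ‖x‖ ^ 2 := by positivity
  rw [← div_le_iff₀ hp]
  refine le_trans (le_of_eq ?_) h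
  field_simp

/-- Take the top eigenvectors above `ε / (n + 1)`; the at most `n` eigenvalues left out sum to at
most `ε`. Fewer than `n` vectors may be available, hence `m`. -/
theorem exists_orthonormal_sum_orderedEigenvalue_le {T : H →L[ℂ] H} (hc : IsCompactOperator T)
    (hs : T.IsSymmetric) (n : ℕ) {ε : ℝ} (hε : 0 < ε) :
    ∃ m ≤ n, ∃ x : Fin m → H, Orthonormal ℂ x ∧
      ∑ i ∈ Finset.range n, orderedEigenvalue T i ≤
        ∑ i, (inner ℂ (x i) (T (x i))).re + ε := by
  have ht0 : 0 < ε / (n + 1) := by positivity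
  set t := ε / (n + 1) with ht
  obtain ⟨B⟩ := nonempty_topEigenbasis hc hs ht0
  have hle : min B.d n ≤ B.d := min_le_left _ _
  refine ⟨min B.d n, min_le_right _ _, fun i => B.e (Fin.castLE hle i),
    B.orthonormal.comp _ (Fin.castLE_injective hle), ?_⟩
  have h1 : ∑ i : Fin (min B.d n), (inner ℂ (B.e (Fin.castLE hle i))
      (T (B.e (Fin.castLE hle i)))).re = ∑ i ∈ Finset.range (min B.d n), orderedEigenvalue T i := by
    rw [← Fin.sum_univ_eq_sum_range]
    refine Finset.sum_congr rfl fun i _ => ?_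
    rw [B.re_inner_e, ← B.orderedEigenvalue_eq ht0.le hs, Fin.val_castLE]
  rw [h1, ← Finset.sum_range_add_sum_Ico _ (min_le_right B.d n)]
  gcongr
  calc ∑ i ∈ Finset.Ico (min B.d n) n, orderedEigenvalue T i
      ≤ ∑ _i ∈ Finset.Ico (min B.d n) n, t := by
        refine Finset.sum_le_sum fun i hi => B.orderedEigenvalue_le_of_le ht0.le ?_
        rw [Finset.mem_Ico] at hi
        omega
    _ = ((n - min B.d n : ℕ) : ℝ) * t := by
        rw [Finset.sum_const, Nat.card_Ico, nsmul_eq_mul]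
    _ ≤ (n + 1) * t := by
        gcongr
        exact_mod_cast (Nat.sub_le _ _).trans (Nat.le_succ n)
    _ = ε := by rw [ht]; field_simp

end KyFan

/-! ### The characteristic function of the Cauchy distribution -/

section Cauchy

open scoped FourierTransform

theorem integrable_exp_neg_abs : Integrable fun v : ℝ => (Real.exp (-|v|) : ℂ) := by
  refine Integrable.ofReal (f := fun v : ℝ => Real.exp (-|v|)) ?_
  rw [← integrableOn_univ, ← Set.Iic_union_Ioi (a := (0 : ℝ)), integrableOn_union]
  constructor
  · refine (integrableOn_exp_Iic 0).congr_fun (fun x hx => ?_) measurableSet_Iic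
    rw [abs_of_nonpos hx, neg_neg]
  · refine (integrableOn_exp_neg_Ioi 0).congr_fun (fun x hx => ?_) measurableSet_Ioi
    simp only
    rw [abs_of_pos hx]

theorem fourier_exp_neg_abs (w : ℝ) :
    𝓕 (fun v : ℝ => (Real.exp (-|v|) : ℂ)) w = (2 * (1 + (2 * Real.pi * w) ^ 2)⁻¹ : ℝ) := by
  rw [Real.fourier_real_eq_integral_exp_smul]
  set b : ℂ := ((2 * Real.pi * w : ℝ) : ℂ) * Complex.I with hb
  have hbre : b.re = 0 := by simp [hb]
  have hIic : Set.EqOn (fun v : ℝ => Complex.exp (((-2 * Real.pi * v * w : ℝ) : ℂ) * Complex.I) •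
      (Real.exp (-|v|) : ℂ)) (fun v : ℝ => Complex.exp ((1 - b) * v)) (Set.Iic 0) := by
    intro v hv
    simp only [smul_eq_mul]
    rw [abs_of_nonpos hv, neg_neg, Complex.ofReal_exp, ← Complex.exp_add, hb]
    congr 1
    push_cast
    ring
  have hIoi : Set.EqOn (fun v : ℝ => Complex.exp (((-2 * Real.pi * v * w : ℝ) : ℂ) * Complex.I) •
      (Real.exp (-|v|) : ℂ)) (fun v : ℝ => Complex.exp ((-1 - b) * v)) (Set.Ioi 0) := by
    intro v hv
    simp only [smul_eq_mul]
    rw [abs_of_pos hv, Complex.ofReal_exp, ← Complex.exp_add, hb]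
    congr 1
    push_cast
    ring
  have h1 : 0 < (1 - b).re := by simp [hbre]
  have h2 : (-1 - b).re < 0 := by simp [hbre]
  rw [← intervalIntegral.integral_Iic_add_Ioi (b := 0)
    ((integrableOn_exp_mul_complex_Iic h1 0).congr_fun hIic.symm measurableSet_Iic)
    ((integrableOn_exp_mul_complex_Ioi h2 0).congr_fun hIoi.symm measurableSet_Ioi),
    setIntegral_congr_fun measurableSet_Iic hIic, setIntegral_congr_fun measurableSet_Ioi hIoi,
    integral_exp_mul_complex_Iic h1, integral_exp_mul_complex_Ioi h2]
  have h1' : (1 - b) ≠ 0 := fun h => by rw [h] at h1; simp at h1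
  have h2' : (-1 - b) ≠ 0 := fun h => by rw [h] at h2; simp at h2
  have h3 : (1 : ℂ) + (2 * Real.pi * w) ^ 2 = -((1 - b) * (-1 - b)) := by
    rw [hb]
    push_cast
    ring_nf
    rw [Complex.I_sq]
    ring
  push_cast
  rw [h3]
  simp only [mul_zero, Complex.exp_zero]
  field_simp
  ring

/-- The characteristic function of the standard Cauchy distribution. -/
theorem integral_exp_cauchyMeasure (d : ℝ) :
    ∫ p, Complex.exp (((p * d : ℝ) : ℂ) * Complex.I) ∂ProbabilityTheory.cauchyMeasure 0 1 =
      (Real.exp (-|d|) : ℂ) := by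
  have hF : 𝓕 (fun v : ℝ => (Real.exp (-|v|) : ℂ)) =
      fun w : ℝ => ((2 * (1 + (2 * Real.pi * w) ^ 2)⁻¹ : ℝ) : ℂ) := funext fourier_exp_neg_abs
  have hFi : Integrable (𝓕 (fun v : ℝ => (Real.exp (-|v|) : ℂ))) := by
    rw [hF]
    exact ((integrable_inv_one_add_sq.comp_mul_left' (by positivity)).const_mul 2).ofReal
  have hcont : Continuous fun v : ℝ => (Real.exp (-|v|) : ℂ) := by fun_prop
  -- Fourier inversion; the substitution `p = 2 π w` then turns the transform into the Cauchy
  -- density.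
  have h := congrFun (hcont.fourierInv_fourier_eq integrable_exp_neg_abs hFi) d
  rw [Real.fourierInv_eq', hF] at h
  rw [← h, ProbabilityTheory.cauchyMeasure_of_scale_ne_zero 0 one_ne_zero,
    integral_withDensity_eq_integral_toReal_smul (ProbabilityTheory.measurable_cauchyPDF 0 1)
      (ae_of_all _ fun x => ENNReal.ofReal_lt_top)]
  have hsub := Measure.integral_comp_mul_left (fun p : ℝ =>
    (ProbabilityTheory.cauchyPDF 0 1 p).toReal • Complex.exp (((p * d : ℝ) : ℂ) * Complex.I)) (2 * Real.pi)
  have hpi := Real.pi_pos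
  rw [abs_of_pos (by positivity), eq_inv_smul_iff₀ (by positivity)] at hsub
  rw [← hsub, ← integral_smul]
  refine integral_congr_ae (ae_of_all _ fun w => ?_)
  have hpdf : (ProbabilityTheory.cauchyPDF 0 1 (2 * Real.pi * w)).toReal =
      Real.pi⁻¹ * (1 + (2 * Real.pi * w) ^ 2)⁻¹ := by
    rw [ProbabilityTheory.cauchyPDF, ENNReal.toReal_ofReal
      (ProbabilityTheory.cauchyPDF_pos 0 one_ne_zero _).le, ProbabilityTheory.cauchyPDFReal_def]
    simp only [sub_zero, NNReal.coe_one, one_pow, mul_one, add_comm]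
  have hin : inner ℝ w d = w * d := mul_comm _ _
  simp only [hpdf, hin, Complex.real_smul, smul_eq_mul]
  rw [← mul_assoc (2 * Real.pi) w d]
  push_cast
  field_simp

end Cauchy

/-! ### Multiplying a kernel by `exp (-|D x - D y|)` as an average of phases -/

section Schur

open ProbabilityTheory

theorem norm_exp_mul_I (r : ℝ) : ‖Complex.exp ((r : ℂ) * Complex.I)‖ = 1 :=
  Complex.norm_exp_ofReal_mul_I r

theorem integrable_mul_exp_cauchyMeasure {F : ℝ × ℝ → ℂ} (hF : Integrable F) {D : ℝ → ℝ}
    (hD : Measurable D) :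
    Integrable (fun w : (ℝ × ℝ) × ℝ =>
      F w.1 * Complex.exp (((w.2 * (D w.1.1 - D w.1.2) : ℝ) : ℂ) * Complex.I))
      ((volume : Measure (ℝ × ℝ)).prod (cauchyMeasure 0 1)) := by
  have hF' := hF.comp_fst (cauchyMeasure 0 1)
  refine hF'.mono (hF'.aestronglyMeasurable.mul (Measurable.aestronglyMeasurable ?_))
    (ae_of_all _ fun w => ?_)
  · fun_prop
  · rw [norm_mul, norm_exp_mul_I, mul_one]

theorem integral_mul_exp_neg_abs_sub {F : ℝ × ℝ → ℂ} (hF : Integrable F) {D : ℝ → ℝ}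
    (hD : Measurable D) :
    ∫ z, F z * (Real.exp (-|D z.1 - D z.2|) : ℂ) =
      ∫ p : ℝ, (∫ z, F z * Complex.exp (((p * (D z.1 - D z.2) : ℝ) : ℂ) * Complex.I))
        ∂cauchyMeasure 0 1 := by
  rw [← integral_integral_swap (integrable_mul_exp_cauchyMeasure hF hD)]
  refine integral_congr_ae (ae_of_all _ fun z => ?_)
  simp only
  rw [integral_const_mul, integral_exp_cauchyMeasure]

end Schur

/-! ### The sesquilinear form and symmetry of the operator -/

section Form

variable {U : ℝ → ℝ} (hU : Integrable U) (κ : Measure ℝ) [IsLocallyFiniteMeasure κ]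

theorem integrable_conj_sqrt_mul (hU : Integrable U) (g : L2R) :
    Integrable fun x => (starRingEnd ℂ) (g x) * (√(U x) : ℂ) := by
  refine (((integrable_sqrt_mul hU g).norm).mono' ?_ (ae_of_all _ fun x => ?_))
  · exact ((Complex.continuous_conj.comp_aestronglyMeasurable (Lp.aestronglyMeasurable g)).mul
      (memLp_sqrt hU).ofReal.aestronglyMeasurable)
  · rw [norm_mul, norm_mul, RCLike.norm_conj, mul_comm]

/-- The integrand of the sesquilinear form of the operator `L^κ`. -/
def formIntegrand (U : ℝ → ℝ) (κ : Measure ℝ) (g f : ℝ → ℂ) (z : ℝ × ℝ) : ℂ :=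
  (starRingEnd ℂ) (g z.1) * ((kernel U κ z.1 z.2 : ℂ) * f z.2)

include hU in
theorem integrable_sqrt_tensor (g f : L2R) :
    Integrable (fun z : ℝ × ℝ => ((starRingEnd ℂ) (g z.1) * (√(U z.1) : ℂ)) *
      ((√(U z.2) : ℂ) * f z.2)) :=
  (integrable_conj_sqrt_mul hU g).mul_prod (integrable_sqrt_mul hU f)

omit [IsLocallyFiniteMeasure κ] in
theorem formIntegrand_eq (g f : ℝ → ℂ) (z : ℝ × ℝ) :
    formIntegrand U κ g f z = (((starRingEnd ℂ) (g z.1) * (√(U z.1) : ℂ)) *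
      ((√(U z.2) : ℂ) * f z.2)) * (Real.exp (-|J κ z.1 - J κ z.2|) : ℂ) := by
  rw [formIntegrand, kernel]
  push_cast
  ring

include hU in
theorem integrable_formIntegrand (g f : L2R) : Integrable (formIntegrand U κ g f) := by
  refine (integrable_sqrt_tensor hU g f).norm.mono'
    ((Complex.continuous_conj.comp_aestronglyMeasurable
      (Lp.aestronglyMeasurable g)).comp_fst.mul (aestronglyMeasurable_kernel hU κ f))
    (ae_of_all _ fun z => ?_)
  rw [formIntegrand_eq, norm_mul]
  refine mul_le_of_le_one_right (norm_nonneg _) ?_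
  rw [Complex.norm_real, Real.norm_eq_abs, Real.abs_exp, Real.exp_le_one_iff]
  exact neg_nonpos.2 (abs_nonneg _)

theorem inner_opL (g f : L2R) :
    inner ℂ g (opL U hU κ f) = ∫ z, formIntegrand U κ g f z := by
  rw [L2.inner_def, Measure.volume_eq_prod, integral_prod _ (integrable_formIntegrand hU κ g f)]
  refine integral_congr_ae ?_
  filter_upwards [coeFn_opL U hU κ f] with x hx
  simp only [formIntegrand]
  rw [integral_const_mul, hx, RCLike.inner_apply, mul_comm]

theorem isSymmetric_opL : (opL U hU κ).IsSymmetric := by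
  intro f g
  change inner ℂ (opL U hU κ f) g = inner ℂ f (opL U hU κ g)
  rw [← inner_conj_symm, inner_opL, inner_opL, ← integral_conj, Measure.volume_eq_prod,
    ← integral_prod_swap]
  refine integral_congr_ae (ae_of_all _ fun z => ?_)
  simp only [formIntegrand, Prod.fst_swap, Prod.snd_swap, map_mul, Complex.conj_conj,
    Complex.conj_ofReal]
  rw [kernel, kernel, abs_sub_comm]
  push_cast
  ring

end Form

/-! ### Phase multiplications and compactness -/

section Compact

open ProbabilityTheory

variable {U : ℝ → ℝ} (hU : Integrable U)

/-- Multiplication of an `L²` function by the phase `exp (i p D)`. -/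
def modulate {D : ℝ → ℝ} (hD : Measurable D) (p : ℝ) (f : L2R) : L2R :=
  MemLp.toLp (fun x => Complex.exp (((p * D x : ℝ) : ℂ) * Complex.I) * f x)
    ((Lp.memLp f).of_le (by
      refine (Measurable.aestronglyMeasurable ?_).mul (Lp.aestronglyMeasurable f)
      fun_prop) (ae_of_all _ fun x => by rw [norm_mul, norm_exp_mul_I, one_mul]))

theorem coeFn_modulate {D : ℝ → ℝ} (hD : Measurable D) (p : ℝ) (f : L2R) :
    modulate hD p f =ᵐ[volume] fun x => Complex.exp (((p * D x : ℝ) : ℂ) * Complex.I) * f x :=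
  MemLp.coeFn_toLp _

theorem conj_exp_mul_I (r : ℝ) : (starRingEnd ℂ) (Complex.exp ((r : ℂ) * Complex.I)) =
    Complex.exp (((-r : ℝ) : ℂ) * Complex.I) := by
  rw [← Complex.exp_conj, map_mul, Complex.conj_ofReal, Complex.conj_I]
  push_cast
  ring_nf

theorem inner_modulate {D : ℝ → ℝ} (hD : Measurable D) (p q : ℝ) (f g : L2R) :
    inner ℂ (modulate hD p f) (modulate hD q g) =
      ∫ x, Complex.exp ((((q - p) * D x : ℝ) : ℂ) * Complex.I) * inner ℂ (f x) (g x) := by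
  rw [L2.inner_def]
  refine integral_congr_ae ?_
  filter_upwards [coeFn_modulate hD p f, coeFn_modulate hD q g] with x h1 h2
  rw [h1, h2, RCLike.inner_apply, RCLike.inner_apply, map_mul, conj_exp_mul_I]
  rw [show (((q - p) * D x : ℝ) : ℂ) * Complex.I =
    ((q * D x : ℝ) : ℂ) * Complex.I + ((-(p * D x) : ℝ) : ℂ) * Complex.I by push_cast; ring,
    Complex.exp_add]
  ring

theorem inner_modulate_self {D : ℝ → ℝ} (hD : Measurable D) (p : ℝ) (f g : L2R) :
    inner ℂ (modulate hD p f) (modulate hD p g) = inner ℂ f g := by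
  rw [inner_modulate, L2.inner_def]
  simp

/-- Phases preserve the norm, so the squared distance reduces to an inner product, continuous in `p`
by dominated convergence. -/
theorem continuous_modulate {D : ℝ → ℝ} (hD : Measurable D) (f : L2R) :
    Continuous fun p => modulate hD p f := by
  have hint : Integrable fun x => (inner ℂ (f x) (f x) : ℂ) := L2.integrable_inner f f
  have hc : Continuous fun p : ℝ =>
      ∫ x, Complex.exp (((p * D x : ℝ) : ℂ) * Complex.I) * inner ℂ (f x) (f x) := by
    refine continuous_of_dominated (bound := fun x => ‖(inner ℂ (f x) (f x) : ℂ)‖) (fun p => ?_)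
      (fun p => ae_of_all _ fun x => ?_) hint.norm (ae_of_all _ fun x => by fun_prop)
    · refine (Measurable.aestronglyMeasurable ?_).mul hint.aestronglyMeasurable
      fun_prop
    · rw [norm_mul, norm_exp_mul_I, one_mul]
  rw [continuous_iff_continuousAt]
  intro q
  rw [ContinuousAt, tendsto_iff_norm_sub_tendsto_zero]
  have hsq : ∀ p, ‖modulate hD p f - modulate hD q f‖ ^ 2 =
      2 * ‖f‖ ^ 2 - 2 * (∫ x, Complex.exp ((((q - p) * D x : ℝ) : ℂ) * Complex.I) *
        inner ℂ (f x) (f x)).re := by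
    intro p
    have hn : ∀ r, ‖modulate hD r f‖ ^ 2 = ‖f‖ ^ 2 := fun r => by
      rw [← inner_self_eq_norm_sq (𝕜 := ℂ), inner_modulate_self, inner_self_eq_norm_sq]
    rw [norm_sub_sq (𝕜 := ℂ), inner_modulate, hn, hn, RCLike.re_to_complex]
    ring
  have hlim : Filter.Tendsto (fun p => ‖modulate hD p f - modulate hD q f‖ ^ 2) (nhds q)
      (nhds 0) := by
    have hcont : Continuous fun p => ‖modulate hD p f - modulate hD q f‖ ^ 2 := by
      simp only [hsq]
      exact continuous_const.sub (continuous_const.mul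
        (Complex.continuous_re.comp (hc.comp (continuous_const.sub continuous_id))))
    have h := hcont.tendsto q
    simpa using h
  have h := hlim.sqrt
  simpa [Real.sqrt_sq (norm_nonneg _)] using h

theorem isCompactOperator_rankOne (x y : L2R) :
    IsCompactOperator (InnerProductSpace.rankOne ℂ x y) := by
  have h : IsCompactOperator (innerSL ℂ y) :=
    isCompactOperator_of_locallyCompactSpace_dom (innerSL ℂ y)
  exact h.clm_comp (ContinuousLinearMap.toSpanSingleton ℂ x)

variable (κ : Measure ℝ) [IsLocallyFiniteMeasure κ]

theorem isCompactOperator_opL : IsCompactOperator (opL U hU κ) := by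
  let s : L2R := (memLp_sqrt hU).ofReal.toLp
  have hs : s =ᵐ[volume] fun x => (√(U x) : ℂ) := MemLp.coeFn_toLp _
  have hJ := measurable_J κ
  let φ : ℝ → L2R := fun p => modulate hJ p s
  have hφ : Continuous φ := continuous_modulate hJ s
  let A : ℝ → L2R →L[ℂ] L2R := fun p => InnerProductSpace.rankOne ℂ (φ p) (φ p)
  have hA : Continuous A := by
    have h1 : Continuous fun p => ContinuousLinearMap.smulRightL ℂ L2R L2R (innerSL ℂ (φ p)) :=
      (ContinuousLinearMap.smulRightL ℂ L2R L2R).continuous.comp ((innerSL ℂ).continuous.comp hφ)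
    exact h1.clm_apply hφ
  have hAi : Integrable A (cauchyMeasure 0 1) := by
    refine Integrable.of_bound hA.aestronglyMeasurable (‖s‖ * ‖s‖) (ae_of_all _ fun p => ?_)
    have hn : ‖φ p‖ = ‖s‖ := by
      rw [← sq_eq_sq₀ (norm_nonneg _) (norm_nonneg _), ← inner_self_eq_norm_sq (𝕜 := ℂ),
        inner_modulate_self, inner_self_eq_norm_sq]
    rw [InnerProductSpace.norm_rankOne, hn]
  have hmem : ∫ p, A p ∂cauchyMeasure 0 1 ∈ {T : L2R →L[ℂ] L2R | IsCompactOperator T} := by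
    -- Compact operators form a closed convex set, and the Cauchy measure is a probability measure.
    refine Convex.integral_mem ?_ isClosed_setOfPred_isCompactOperator
      (ae_of_all _ fun p => isCompactOperator_rankOne _ _) hAi
    exact ((compactOperator (RingHom.id ℂ) L2R L2R).restrictScalars ℝ).convex
  have heq : opL U hU κ = ∫ p, A p ∂cauchyMeasure 0 1 := by
    ext1 f
    refine ext_inner_left ℂ fun g => ?_
    rw [inner_opL, ContinuousLinearMap.integral_apply hAi,
      ← integral_inner (hAi.apply_continuousLinearMap f)]
    simp only [formIntegrand_eq]
    rw [integral_mul_exp_neg_abs_sub (integrable_sqrt_tensor hU g f) hJ]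
    refine integral_congr_ae (ae_of_all _ fun p => ?_)
    simp only [A, InnerProductSpace.rankOne_apply, inner_smul_right, L2.inner_def]
    rw [mul_comm, ← integral_prod_mul, ← Measure.volume_eq_prod]
    refine integral_congr_ae ?_
    have hs' : φ p =ᵐ[volume] fun x => Complex.exp (((p * J κ x : ℝ) : ℂ) * Complex.I) *
        (√(U x) : ℂ) := by
      filter_upwards [coeFn_modulate hJ p s, hs] with x h1 h2
      rw [h1, h2]
    filter_upwards [Measure.quasiMeasurePreserving_fst.ae hs',
      Measure.quasiMeasurePreserving_snd.ae hs'] with z h1 h2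
    simp only [RCLike.inner_apply]
    rw [h1, h2, map_mul, conj_exp_mul_I, Complex.conj_ofReal,
      show ((p * (J κ z.1 - J κ z.2) : ℝ) : ℂ) * Complex.I =
        ((p * J κ z.1 : ℝ) : ℂ) * Complex.I + ((-(p * J κ z.2) : ℝ) : ℂ) * Complex.I by
          push_cast; ring, Complex.exp_add]
    ring
  rw [heq]
  exact hmem

end Compact

/-! ### Pointwise comparison of the two kernels -/

section Comparison

variable {κ κ' : Measure ℝ} [IsLocallyFiniteMeasure κ] [IsLocallyFiniteMeasure κ']

-- Inner regularity: a compact subset of `I` lies in the closed interval between its extreme points,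
-- which is still inside `I`.
omit [IsLocallyFiniteMeasure κ'] in
theorem measure_le_of_ordConnected (hκ : ∀ s t : ℝ, s ≤ t → κ (Set.Icc s t) ≤ κ' (Set.Icc s t))
    {I : Set ℝ} (hI : I.OrdConnected) (hm : MeasurableSet I) : κ I ≤ κ' I := by
  refine le_of_forall_lt fun r hr => ?_
  obtain ⟨K, hKI, hK, hrK⟩ := hm.exists_lt_isCompact hr
  have hne : K.Nonempty := by
    rw [Set.nonempty_iff_ne_empty]
    rintro rfl
    simp at hrK
  have h1 := hK.sInf_mem hne
  have h2 := hK.sSup_mem hne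
  have hsub : K ⊆ Set.Icc (sInf K) (sSup K) :=
    subset_Icc_csInf_csSup hK.bddBelow hK.bddAbove
  calc r < κ K := hrK
    _ ≤ κ (Set.Icc (sInf K) (sSup K)) := measure_mono hsub
    _ ≤ κ' (Set.Icc (sInf K) (sSup K)) := hκ _ _ (hsub h1).2
    _ ≤ κ' I := measure_mono (hI.out (hKI h1) (hKI h2))

theorem J_sub_J (κ : Measure ℝ) [IsLocallyFiniteMeasure κ] {x y : ℝ} (hxy : x ≤ y) :
    J κ y - J κ x = κ.real (Set.Ioc x y) := by
  have hi : ∀ a b : ℝ, IntervalIntegrable (fun _ : ℝ => (1 : ℝ)) κ a b :=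
    fun a b => intervalIntegrable_const
  rw [J, J, intervalIntegral.integral_interval_sub_left (hi 0 y) (hi 0 x),
    intervalIntegral.integral_of_le hxy, setIntegral_const, smul_eq_mul, mul_one]

theorem monotone_J (κ : Measure ℝ) [IsLocallyFiniteMeasure κ] : Monotone (J κ) := fun x y hxy => by
  have h := J_sub_J κ hxy
  have h' : 0 ≤ κ.real (Set.Ioc x y) := measureReal_nonneg
  linarith

theorem monotone_J_sub_J (hκ : ∀ s t : ℝ, s ≤ t → κ (Set.Icc s t) ≤ κ' (Set.Icc s t)) :
    Monotone fun x => J κ' x - J κ x := fun x y hxy => by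
  have h1 := J_sub_J κ hxy
  have h2 := J_sub_J κ' hxy
  have h3 : κ.real (Set.Ioc x y) ≤ κ'.real (Set.Ioc x y) :=
    ENNReal.toReal_mono measure_Ioc_lt_top.ne
      (measure_le_of_ordConnected hκ Set.ordConnected_Ioc measurableSet_Ioc)
  simp only
  linarith

/-- The increment of `J` sees only `(x, y]`, so `x < s` must be strict for it to contain `[s, t]`,
while `t = y` is allowed. -/
theorem J_sub_J_lt (hκ : ∀ s t : ℝ, s ≤ t → κ (Set.Icc s t) ≤ κ' (Set.Icc s t)) {s t x y : ℝ}
    (hst : s ≤ t) (h : κ (Set.Icc s t) < κ' (Set.Icc s t)) (hx : x < s) (hy : t ≤ y) :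
    J κ' x - J κ x < J κ' y - J κ y := by
  have hxy : x ≤ y := by linarith
  have hdec : Set.Ioc x y = Set.Ioo x s ∪ (Set.Icc s t ∪ Set.Ioc t y) := by
    rw [Set.Icc_union_Ioc_eq_Icc hst hy, Set.Ioo_union_Icc_eq_Ioc hx (hst.trans hy)]
  have hd1 : Disjoint (Set.Ioo x s) (Set.Icc s t ∪ Set.Ioc t y) := by
    rw [Set.Icc_union_Ioc_eq_Icc hst hy, Set.disjoint_left]
    exact fun z hz hz' => absurd hz'.1 (not_le.2 hz.2)
  have hd2 : Disjoint (Set.Icc s t) (Set.Ioc t y) := by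
    rw [Set.disjoint_left]
    exact fun z hz hz' => absurd hz.2 (not_le.2 hz'.1)
  have hm : ∀ μ : Measure ℝ, μ (Set.Ioc x y) =
      μ (Set.Icc s t) + (μ (Set.Ioo x s) + μ (Set.Ioc t y)) := fun μ => by
    rw [hdec, measure_union hd1 (measurableSet_Icc.union measurableSet_Ioc),
      measure_union hd2 measurableSet_Ioc]
    ring
  have hlt : κ (Set.Ioc x y) < κ' (Set.Ioc x y) := by
    rw [hm κ, hm κ']
    refine ENNReal.add_lt_add_of_lt_of_le ?_ h (add_le_add
      (measure_le_of_ordConnected hκ Set.ordConnected_Ioo measurableSet_Ioo)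
      (measure_le_of_ordConnected hκ Set.ordConnected_Ioc measurableSet_Ioc))
    exact ENNReal.add_ne_top.2 ⟨measure_Ioo_lt_top.ne, measure_Ioc_lt_top.ne⟩
  have h3 : κ.real (Set.Ioc x y) < κ'.real (Set.Ioc x y) :=
    (ENNReal.toReal_lt_toReal measure_Ioc_lt_top.ne measure_Ioc_lt_top.ne).2 hlt
  have h1 := J_sub_J κ hxy
  have h2 := J_sub_J κ' hxy
  linarith

/-- The increments of `J κ` and of `J κ' - J κ` have the same sign, so their absolute values add. -/
theorem kernel_eq_mul (hκ : ∀ s t : ℝ, s ≤ t → κ (Set.Icc s t) ≤ κ' (Set.Icc s t)) (U : ℝ → ℝ)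
    (x y : ℝ) : kernel U κ' x y =
      kernel U κ x y * Real.exp (-|(J κ' x - J κ x) - (J κ' y - J κ y)|) := by
  have habs : |J κ' x - J κ' y| =
      |J κ x - J κ y| + |(J κ' x - J κ x) - (J κ' y - J κ y)| := by
    rcases le_total x y with h | h
    · have h1 := monotone_J κ h
      have h2 := monotone_J κ' h
      have h3 := monotone_J_sub_J hκ h
      simp only at h3
      rw [abs_of_nonpos (by linarith), abs_of_nonpos (by linarith), abs_of_nonpos (by linarith)]
      ring
    · have h1 := monotone_J κ h
      have h2 := monotone_J κ' h
      have h3 := monotone_J_sub_J hκ h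
      simp only at h3
      rw [abs_of_nonneg (by linarith), abs_of_nonneg (by linarith), abs_of_nonneg (by linarith)]
      ring
  rw [kernel, kernel, habs, neg_add, Real.exp_add]
  ring

theorem kernel_nonneg (U : ℝ → ℝ) (κ : Measure ℝ) (x y : ℝ) : 0 ≤ kernel U κ x y := by
  rw [kernel]
  positivity

theorem kernel_pos {U : ℝ → ℝ} (κ : Measure ℝ) {x y : ℝ} (hx : 0 < U x) (hy : 0 < U y) :
    0 < kernel U κ x y := by
  rw [kernel]
  have := Real.sqrt_pos.2 hx
  have := Real.sqrt_pos.2 hy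
  positivity

theorem kernel_le (hκ : ∀ s t : ℝ, s ≤ t → κ (Set.Icc s t) ≤ κ' (Set.Icc s t)) (U : ℝ → ℝ)
    (x y : ℝ) : kernel U κ' x y ≤ kernel U κ x y := by
  rw [kernel_eq_mul hκ]
  refine mul_le_of_le_one_right (kernel_nonneg U κ x y) ?_
  rw [Real.exp_le_one_iff]
  exact neg_nonpos.2 (abs_nonneg _)

theorem kernel_lt (hκ : ∀ s t : ℝ, s ≤ t → κ (Set.Icc s t) ≤ κ' (Set.Icc s t)) {U : ℝ → ℝ}
    {s t x y : ℝ} (hst : s ≤ t) (h : κ (Set.Icc s t) < κ' (Set.Icc s t)) (hx : x < s) (hy : t ≤ y)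
    (hUx : 0 < U x) (hUy : 0 < U y) : kernel U κ' x y < kernel U κ x y := by
  rw [kernel_eq_mul hκ]
  refine mul_lt_of_lt_one_right (kernel_pos κ hUx hUy) ?_
  rw [Real.exp_lt_one_iff, neg_lt_zero, abs_pos, sub_ne_zero]
  exact (J_sub_J_lt hκ hst h hx hy).ne

end Comparison

/-! ### Unitary averaging and the inequality for eigenvalue sums -/

section Majorization

open ProbabilityTheory

variable {U : ℝ → ℝ} (hU : Integrable U) {κ κ' : Measure ℝ} [IsLocallyFiniteMeasure κ]
  [IsLocallyFiniteMeasure κ']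

theorem measurable_J_sub_J (κ κ' : Measure ℝ) [IsLocallyFiniteMeasure κ]
    [IsLocallyFiniteMeasure κ'] : Measurable fun x => J κ' x - J κ x :=
  (measurable_J κ').sub (measurable_J κ)

-- Conjugation in the first slot flips the sign, so the phase `-p` produces `exp (i p (D x - D y))`.
omit [IsLocallyFiniteMeasure κ] in
theorem formIntegrand_modulate {D : ℝ → ℝ} (hD : Measurable D) (p : ℝ) (g f : L2R) :
    formIntegrand U κ (modulate hD (-p) g) (modulate hD (-p) f) =ᵐ[volume]
      fun z => formIntegrand U κ g f z *
        Complex.exp (((p * (D z.1 - D z.2) : ℝ) : ℂ) * Complex.I) := by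
  filter_upwards [Measure.quasiMeasurePreserving_fst.ae (coeFn_modulate hD (-p) g),
    Measure.quasiMeasurePreserving_snd.ae (coeFn_modulate hD (-p) f)] with z h1 h2
  simp only [formIntegrand]
  rw [h1, h2, map_mul, conj_exp_mul_I,
    show ((p * (D z.1 - D z.2) : ℝ) : ℂ) * Complex.I =
      ((-(-p * D z.1) : ℝ) : ℂ) * Complex.I + ((-p * D z.2 : ℝ) : ℂ) * Complex.I by
        push_cast; ring, Complex.exp_add]
  ring

theorem inner_opL_modulate {D : ℝ → ℝ} (hD : Measurable D) (p : ℝ) (g f : L2R) :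
    inner ℂ (modulate hD (-p) g) (opL U hU κ (modulate hD (-p) f)) =
      ∫ z, formIntegrand U κ g f z *
        Complex.exp (((p * (D z.1 - D z.2) : ℝ) : ℂ) * Complex.I) := by
  rw [inner_opL]
  exact integral_congr_ae (formIntegrand_modulate hD p g f)

theorem integrable_inner_opL_modulate {D : ℝ → ℝ} (hD : Measurable D) (g f : L2R) :
    Integrable (fun p => inner ℂ (modulate hD (-p) g) (opL U hU κ (modulate hD (-p) f)))
      (cauchyMeasure 0 1) := by
  simp only [inner_opL_modulate]
  exact (integrable_mul_exp_cauchyMeasure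
    (integrable_formIntegrand hU κ g f) hD).integral_prod_right

theorem inner_opL_eq_integral (hκ : ∀ s t : ℝ, s ≤ t → κ (Set.Icc s t) ≤ κ' (Set.Icc s t))
    (g f : L2R) : inner ℂ g (opL U hU κ' f) =
      ∫ p, inner ℂ (modulate (measurable_J_sub_J κ κ') (-p) g)
        (opL U hU κ (modulate (measurable_J_sub_J κ κ') (-p) f)) ∂cauchyMeasure 0 1 := by
  simp only [inner_opL_modulate]
  rw [inner_opL, ← integral_mul_exp_neg_abs_sub (integrable_formIntegrand hU κ g f)
    (measurable_J_sub_J κ κ')]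
  refine integral_congr_ae (ae_of_all _ fun z => ?_)
  simp only [formIntegrand]
  rw [kernel_eq_mul hκ]
  push_cast
  ring

/-- Ky Fan applies for every `p`, because the modulated system is again orthonormal; then integrate
over `p`. -/
theorem sum_re_inner_opL_le (hκ : ∀ s t : ℝ, s ≤ t → κ (Set.Icc s t) ≤ κ' (Set.Icc s t))
    {m : ℕ} {x : Fin m → L2R} (hx : Orthonormal ℂ x) :
    ∑ i, (inner ℂ (x i) (opL U hU κ' (x i))).re ≤
      ∑ i ∈ Finset.range m, orderedEigenvalue (opL U hU κ) i := by
  have hD := measurable_J_sub_J κ κ'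
  have hint := fun i => (integrable_inner_opL_modulate hU (κ := κ) hD (x i) (x i)).re
  simp only [RCLike.re_to_complex] at hint
  have h1 : ∑ i, (inner ℂ (x i) (opL U hU κ' (x i))).re =
      ∫ p, ∑ i, (inner ℂ (modulate hD (-p) (x i)) (opL U hU κ (modulate hD (-p) (x i)))).re
        ∂cauchyMeasure 0 1 := by
    rw [integral_finsetSum _ fun i _ => hint i]
    refine Finset.sum_congr rfl fun i _ => ?_
    rw [inner_opL_eq_integral hU hκ]
    exact (integral_re (integrable_inner_opL_modulate hU hD (x i) (x i))).symm
  rw [h1]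
  calc _ ≤ ∫ _p, ∑ i ∈ Finset.range m, orderedEigenvalue (opL U hU κ) i ∂cauchyMeasure 0 1 := by
        refine integral_mono (integrable_finsetSum _ fun i _ => hint i) (integrable_const _)
          fun p => ?_
        refine sum_re_inner_le_sum_orderedEigenvalue (isCompactOperator_opL hU κ)
          (isSymmetric_opL hU κ) ?_
        rw [orthonormal_iff_ite] at hx ⊢
        intro i j
        rw [inner_modulate_self, hx]
    _ = _ := by simp

theorem sum_orderedEigenvalue_opL_le
    (hκ : ∀ s t : ℝ, s ≤ t → κ (Set.Icc s t) ≤ κ' (Set.Icc s t)) (n : ℕ) :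
    ∑ i ∈ Finset.range n, orderedEigenvalue (opL U hU κ') i ≤
      ∑ i ∈ Finset.range n, orderedEigenvalue (opL U hU κ) i := by
  refine le_of_forall_pos_le_add fun ε hε => ?_
  obtain ⟨m, hm, x, hx, hle⟩ := exists_orthonormal_sum_orderedEigenvalue_le
    (isCompactOperator_opL hU κ') (isSymmetric_opL hU κ') n hε
  refine hle.trans (add_le_add_left ((sum_re_inner_opL_le hU hκ hx).trans ?_) ε)
  exact Finset.sum_le_sum_of_subset_of_nonneg (Finset.range_subset_range.2 hm)
    fun i _ _ => orderedEigenvalue_nonneg _ i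

end Majorization

/-! ### Ground states and strict monotonicity -/

section Strict

theorem integral_prod_pos {F : ℝ × ℝ → ℝ} (hF : Integrable F) (h0 : ∀ z, 0 ≤ F z) {A B : Set ℝ}
    (hA : 0 < volume A) (hB : 0 < volume B) {P : ℝ → Prop} (hP : ∀ᵐ x, P x)
    (h : ∀ x ∈ A, ∀ y ∈ B, P x → P y → 0 < F (x, y)) : 0 < ∫ z, F z := by
  refine lt_of_le_of_ne (integral_nonneg h0) fun heq => ?_
  have hz := (integral_eq_zero_iff_of_nonneg h0 hF).1 heq.symm
  have hnull : volume (A ×ˢ B) = 0 := by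
    have hae : ∀ᵐ z : ℝ × ℝ, z ∉ A ×ˢ B := by
      filter_upwards [hz, Measure.quasiMeasurePreserving_fst.ae hP,
        Measure.quasiMeasurePreserving_snd.ae hP] with z h1 h2 h3 hmem
      exact (h z.1 hmem.1 z.2 hmem.2 h2 h3).ne' h1
    exact measure_eq_zero_iff_ae_notMem.2 hae
  rw [Measure.volume_eq_prod, Measure.prod_prod, mul_eq_zero] at hnull
  rcases hnull with h' | h'
  · exact hA.ne' h'
  · exact hB.ne' h'

variable {U : ℝ → ℝ} (hU : Integrable U) {κ κ' : Measure ℝ} [IsLocallyFiniteMeasure κ]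
  [IsLocallyFiniteMeasure κ']

/-- The pointwise absolute value of an `L²` function. -/
def absL2 (f : L2R) : L2R := (Lp.memLp f).norm.ofReal.toLp

theorem coeFn_absL2 (f : L2R) : absL2 f =ᵐ[volume] fun x => ((‖f x‖ : ℝ) : ℂ) :=
  MemLp.coeFn_toLp _

theorem norm_absL2 (f : L2R) : ‖absL2 f‖ = ‖f‖ := by
  refine le_antisymm (Lp.norm_le_norm_of_ae_le ?_) (Lp.norm_le_norm_of_ae_le ?_) <;>
  · filter_upwards [coeFn_absL2 f] with x hx
    rw [hx, Complex.norm_real, norm_norm]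

theorem norm_formIntegrand (U : ℝ → ℝ) (κ : Measure ℝ) (f : ℝ → ℂ) (z : ℝ × ℝ) :
    ‖formIntegrand U κ f f z‖ = kernel U κ z.1 z.2 * (‖f z.1‖ * ‖f z.2‖) := by
  rw [formIntegrand, norm_mul, norm_mul, RCLike.norm_conj, Complex.norm_real, Real.norm_eq_abs,
    abs_of_nonneg (kernel_nonneg U κ _ _)]
  ring

include hU in
theorem integrable_kernel_mul_norm (κ : Measure ℝ) [IsLocallyFiniteMeasure κ] (f : L2R) :
    Integrable fun z : ℝ × ℝ => kernel U κ z.1 z.2 * (‖f z.1‖ * ‖f z.2‖) := by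
  simpa only [norm_formIntegrand] using (integrable_formIntegrand hU κ f f).norm

theorem inner_absL2_opL (κ : Measure ℝ) [IsLocallyFiniteMeasure κ] (f : L2R) :
    (inner ℂ (absL2 f) (opL U hU κ (absL2 f))).re =
      ∫ z : ℝ × ℝ, kernel U κ z.1 z.2 * (‖f z.1‖ * ‖f z.2‖) := by
  have h : inner ℂ (absL2 f) (opL U hU κ (absL2 f)) =
      ((∫ z : ℝ × ℝ, kernel U κ z.1 z.2 * (‖f z.1‖ * ‖f z.2‖) : ℝ) : ℂ) := by
    rw [inner_opL, ← integral_complex_ofReal]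
    refine integral_congr_ae ?_
    filter_upwards [Measure.quasiMeasurePreserving_fst.ae (coeFn_absL2 f),
      Measure.quasiMeasurePreserving_snd.ae (coeFn_absL2 f)] with z h1 h2
    rw [formIntegrand, h1, h2, Complex.conj_ofReal]
    push_cast
    ring
  rw [h, Complex.ofReal_re]

theorem re_inner_opL_le_absL2 (κ : Measure ℝ) [IsLocallyFiniteMeasure κ] (f : L2R) :
    (inner ℂ f (opL U hU κ f)).re ≤ (inner ℂ (absL2 f) (opL U hU κ (absL2 f))).re := by
  rw [inner_absL2_opL, inner_opL]
  refine (Complex.re_le_norm _).trans ((norm_integral_le_integral_norm _).trans (le_of_eq ?_))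
  simp only [norm_formIntegrand]

/-- The form is positive at the trial function `√U`. -/
theorem orderedEigenvalue_opL_zero_pos (κ : Measure ℝ) [IsLocallyFiniteMeasure κ]
    (hpos : 0 < volume {x | 0 < U x}) : 0 < orderedEigenvalue (opL U hU κ) 0 := by
  let s : L2R := (memLp_sqrt hU).ofReal.toLp
  have hs : s =ᵐ[volume] fun x => (√(U x) : ℂ) := MemLp.coeFn_toLp _
  have h1 : 0 < ∫ z : ℝ × ℝ, kernel U κ z.1 z.2 * (‖s z.1‖ * ‖s z.2‖) := by
    refine integral_prod_pos (integrable_kernel_mul_norm hU κ s)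
      (fun z => mul_nonneg (kernel_nonneg U κ _ _) (by positivity)) hpos hpos hs
      fun x hx y hy hsx hsy => ?_
    have hk := kernel_pos κ hx hy
    have h1 := Real.sqrt_pos.2 hx
    have h2 := Real.sqrt_pos.2 hy
    rw [hsx, hsy, Complex.norm_real, Complex.norm_real, Real.norm_of_nonneg h1.le,
      Real.norm_of_nonneg h2.le]
    positivity
  rw [← inner_absL2_opL hU] at h1
  have h2 := h1.trans_le (re_inner_le_orderedEigenvalue_zero (isCompactOperator_opL hU κ)
    (isSymmetric_opL hU κ) (absL2 s))
  exact pos_of_mul_pos_left h2 (by positivity)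

/-- A maximiser of the quadratic form on the unit sphere is a critical point of the Rayleigh
quotient. -/
theorem apply_eq_smul_of_re_inner_eq {H : Type*} [NormedAddCommGroup H] [InnerProductSpace ℂ H]
    [CompleteSpace H] {T : H →L[ℂ] H} (hs : T.IsSymmetric) {c : ℝ}
    (hle : ∀ x, (inner ℂ x (T x)).re ≤ c * ‖x‖ ^ 2) {g : H} (hg : ‖g‖ = 1)
    (heq : (inner ℂ g (T g)).re = c) : T g = (c : ℂ) • g := by
  have hre : ∀ x, T.reApplyInnerSelf x = (inner ℂ x (T x)).re := fun x => by
    rw [ContinuousLinearMap.reApplyInnerSelf_apply, inner_re_symm]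
    rfl
  have hmax : IsMaxOn T.reApplyInnerSelf (Metric.sphere (0 : H) ‖g‖) g := by
    intro x hx
    rw [mem_sphere_zero_iff_norm, hg] at hx
    change T.reApplyInnerSelf x ≤ T.reApplyInnerSelf g
    have h := hle x
    rw [hx] at h
    rw [hre, hre, heq]
    linarith
  have h := hs.isSelfAdjoint.eq_smul_self_of_isLocalExtrOn (Or.inr hmax.localize)
  rw [ContinuousLinearMap.rayleighQuotient, hre, heq, hg] at h
  simpa using h

-- The kernel is nonnegative, so `|f|` maximises the form too and is an eigenvector. If it vanished
-- at a generic `x` with `U x > 0`, the eigenvalue equation there would give `√U f = 0` almost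
-- everywhere, and the top eigenvalue would be `0`.
include hU in
theorem exists_groundState (κ : Measure ℝ) [IsLocallyFiniteMeasure κ]
    (hpos : 0 < orderedEigenvalue (opL U hU κ) 0) :
    ∃ f : L2R, ‖f‖ = 1 ∧
      (∫ z : ℝ × ℝ, kernel U κ z.1 z.2 * (‖f z.1‖ * ‖f z.2‖)) =
        orderedEigenvalue (opL U hU κ) 0 ∧
      ∀ᵐ x, 0 < U x → 0 < ‖f x‖ := by
  set c := orderedEigenvalue (opL U hU κ) 0 with hc
  have hT := isCompactOperator_opL hU κ
  have hs := isSymmetric_opL hU κ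
  -- Any threshold strictly between `0` and `c` would do; it guarantees a first eigenvector.
  obtain ⟨B⟩ := nonempty_topEigenbasis hT hs (half_pos hpos)
  have hd : 0 < B.d := by
    by_contra! h
    have := B.orderedEigenvalue_le_of_le (half_pos hpos).le h
    linarith
  set f := B.e ⟨0, hd⟩ with hf
  have hfn : ‖f‖ = 1 := B.orthonormal.1 _
  have hfc : (inner ℂ f (opL U hU κ f)).re = c := by
    rw [hf, B.re_inner_e, ← B.orderedEigenvalue_eq (half_pos hpos).le hs]
  have hgn : ‖absL2 f‖ = 1 := by rw [norm_absL2, hfn]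
  have hle := re_inner_le_orderedEigenvalue_zero hT hs
  have hgc : (inner ℂ (absL2 f) (opL U hU κ (absL2 f))).re = c := by
    refine le_antisymm ?_ (hfc.symm.le.trans (re_inner_opL_le_absL2 hU κ f))
    have h := hle (absL2 f)
    rwa [hgn, one_pow, mul_one] at h
  have hg := apply_eq_smul_of_re_inner_eq hs hle hgn hgc
  refine ⟨f, hfn, by rw [← hgc, inner_absL2_opL], ?_⟩
  by_cases hz : ∀ᵐ y, (√(U y) : ℂ) * f y = 0
  · exfalso
    have h0 : inner ℂ f (opL U hU κ f) = 0 := by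
      rw [inner_opL, ← integral_zero (ℝ × ℝ) ℂ]
      refine integral_congr_ae ?_
      filter_upwards [Measure.quasiMeasurePreserving_snd.ae hz] with z h
      rw [formIntegrand_eq, h, mul_zero, zero_mul]
    rw [h0, Complex.zero_re] at hfc
    exact hpos.ne hfc
  · have hae := coeFn_absL2 f
    have hsm := Lp.coeFn_smul (c : ℂ) (absL2 f)
    rw [← hg] at hsm
    filter_upwards [hsm, coeFn_opL U hU κ (absL2 f), hae] with x h1 h2 h3 hUx
    by_contra! hfx
    have hfx0 : ‖f x‖ = 0 := le_antisymm hfx (norm_nonneg _)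
    rw [h1, Pi.smul_apply, h3, hfx0, Complex.ofReal_zero, smul_zero] at h2
    have h4 : ∫ y, kernel U κ x y * ‖f y‖ = 0 := by
      apply Complex.ofReal_injective
      rw [← integral_complex_ofReal, Complex.ofReal_zero, h2]
      refine integral_congr_ae ?_
      filter_upwards [hae] with y hy
      rw [hy]
      simp
    have hint : Integrable fun y => kernel U κ x y * ‖f y‖ := by
      refine (integrable_kernel_mul hU κ f x).norm.congr (ae_of_all _ fun y => ?_)
      simp only
      rw [norm_mul, Complex.norm_real, Real.norm_of_nonneg (kernel_nonneg U κ x y)]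
    have h5 := (integral_eq_zero_iff_of_nonneg
      (fun y => mul_nonneg (kernel_nonneg U κ x y) (norm_nonneg _)) hint).1 h4
    apply hz
    filter_upwards [h5] with y hy
    have hxs := Real.sqrt_pos.2 hUx
    simp only [kernel, Pi.zero_apply, mul_eq_zero, norm_eq_zero, Real.exp_ne_zero, hxs.ne',
      or_false, false_or] at hy
    rcases hy with hy | hy
    · rw [hy, Complex.ofReal_zero, zero_mul]
    · rw [hy, mul_zero]

theorem orderedEigenvalue_opL_zero_lt
    (hκ : ∀ s t : ℝ, s ≤ t → κ (Set.Icc s t) ≤ κ' (Set.Icc s t)) {s t : ℝ} (hst : s ≤ t)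
    (h : κ (Set.Icc s t) < κ' (Set.Icc s t)) (hs : 0 < volume ({x | 0 < U x} ∩ Set.Iio s))
    (ht : 0 < volume ({x | 0 < U x} ∩ Set.Ici t)) :
    orderedEigenvalue (opL U hU κ') 0 < orderedEigenvalue (opL U hU κ) 0 := by
  have hpos := orderedEigenvalue_opL_zero_pos hU κ'
    (hs.trans_le (measure_mono Set.inter_subset_left))
  obtain ⟨f, hfn, hfc, hf⟩ := exists_groundState hU κ' hpos
  have hle := re_inner_le_orderedEigenvalue_zero (isCompactOperator_opL hU κ)
    (isSymmetric_opL hU κ) (absL2 f)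
  rw [inner_absL2_opL, norm_absL2, hfn, one_pow, mul_one] at hle
  refine lt_of_lt_of_le ?_ hle
  rw [← hfc, ← sub_pos, ← integral_sub (integrable_kernel_mul_norm hU κ f)
    (integrable_kernel_mul_norm hU κ' f)]
  refine integral_prod_pos ((integrable_kernel_mul_norm hU κ f).sub
    (integrable_kernel_mul_norm hU κ' f)) (fun z => ?_) hs ht hf fun x hx y hy hfx hfy => ?_
  · rw [← sub_mul]
    exact mul_nonneg (sub_nonneg.2 (kernel_le hκ U _ _)) (by positivity)
  · rw [← sub_mul]
    exact mul_pos (sub_pos.2 (kernel_lt hκ hst h hx.2 hy.2 hx.1 hy.1))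
      (mul_pos (hfx hx.1) (hfy hy.1))

/-- Pick a density-type point of `A`, remove it and pick a second; every neighbourhood of either
meets `A` in positive measure. The thirds of the segment between them separate the two. -/
theorem exists_lt_measure_inter_pos {A : Set ℝ} (hA : volume A ≠ 0) :
    ∃ s t : ℝ, s < t ∧ 0 < volume (A ∩ Set.Iio s) ∧ 0 < volume (A ∩ Set.Ici t) := by
  have hA' : ∀ x, volume (A \ {x}) ≠ 0 := fun x => by
    rwa [measure_sdiff_null (by simp)]
  obtain ⟨x, -, hx⟩ := exists_mem_forall_mem_nhdsWithin_pos_measure hA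
  obtain ⟨y, hyA, hy⟩ := exists_mem_forall_mem_nhdsWithin_pos_measure (hA' x)
  have key : ∀ a b : ℝ, a < b → (∀ O ∈ nhds a, 0 < volume (A ∩ O)) →
      (∀ O ∈ nhds b, 0 < volume (A ∩ O)) →
      ∃ s t : ℝ, s < t ∧ 0 < volume (A ∩ Set.Iio s) ∧ 0 < volume (A ∩ Set.Ici t) := by
    intro a b hab ha hb
    exact ⟨(2 * a + b) / 3, (a + 2 * b) / 3, by linarith, ha _ (Iio_mem_nhds (by linarith)),
      hb _ (Ici_mem_nhds (by linarith))⟩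
  have hx' : ∀ O ∈ nhds x, 0 < volume (A ∩ O) := fun O hO =>
    hx _ (inter_mem_nhdsWithin A hO)
  have hy' : ∀ O ∈ nhds y, 0 < volume (A ∩ O) := fun O hO =>
    (hy _ (inter_mem_nhdsWithin _ hO)).trans_le
      (measure_mono (Set.inter_subset_inter_left _ Set.sdiff_subset))
  rcases lt_or_gt_of_ne (show y ≠ x from hyA.2) with h | h
  · exact key y x h hy' hx'
  · exact key x y h hx' hy'

theorem measure_inter_pos_of_setIntegral_pos (hU0 : ∀ x, 0 ≤ U x) (hU : Integrable U) {S : Set ℝ}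
    (h : 0 < ∫ x in S, U x) : 0 < volume ({x | 0 < U x} ∩ S) := by
  rw [setIntegral_pos_iff_support_of_nonneg_ae (ae_of_all _ hU0) hU.integrableOn] at h
  refine h.trans_le (measure_mono (Set.inter_subset_inter_left _ fun x hx => ?_))
  exact lt_of_le_of_ne (hU0 x) (Ne.symm hx)

end Strict

end LiebThirring

end

theorem mainTheorem4 (U : ℝ → ℝ) (hU0 : ∀ x, 0 ≤ U x) (hU : Integrable U)
    (κ κ' : Measure ℝ)
    [IsLocallyFiniteMeasure κ] [IsLocallyFiniteMeasure κ']
    (hκ : ∀ s t : ℝ, s ≤ t → κ (Set.Icc s t) ≤ κ' (Set.Icc s t)) :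
    (∀ n : ℕ,
      ∑ i ∈ Finset.range n, LiebThirring.orderedEigenvalue (LiebThirring.opL U hU κ') i ≤
        ∑ i ∈ Finset.range n, LiebThirring.orderedEigenvalue (LiebThirring.opL U hU κ) i) ∧
    ((∃ s t : ℝ, s ≤ t ∧ κ (Set.Icc s t) < κ' (Set.Icc s t) ∧
        (0 < ∫ x in Set.Iic s, U x) ∧ (0 < ∫ x in Set.Ici t, U x)) →
      LiebThirring.orderedEigenvalue (LiebThirring.opL U hU κ') 0 <
        LiebThirring.orderedEigenvalue (LiebThirring.opL U hU κ) 0) ∧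
    ((∀ s t : ℝ, s < t → κ (Set.Icc s t) < κ' (Set.Icc s t)) →
      (¬ ∀ᵐ x, U x = 0) →
      LiebThirring.orderedEigenvalue (LiebThirring.opL U hU κ') 0 <
        LiebThirring.orderedEigenvalue (LiebThirring.opL U hU κ) 0) := by
  refine ⟨LiebThirring.sum_orderedEigenvalue_opL_le hU hκ, ?_, ?_⟩
  · rintro ⟨s, t, hst, h, hs, ht⟩
    -- Lebesgue measure ignores the endpoint `s`, which supplies the strict `x < s` needed by
    -- `J_sub_J_lt`.
    rw [integral_Iic_eq_integral_Iio] at hs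
    exact LiebThirring.orderedEigenvalue_opL_zero_lt hU hκ hst h
      (LiebThirring.measure_inter_pos_of_setIntegral_pos hU0 hU hs)
      (LiebThirring.measure_inter_pos_of_setIntegral_pos hU0 hU ht)
  · intro h hne
    have hA : volume {x | 0 < U x} ≠ 0 := fun hz => hne (by
      rw [ae_iff]
      exact measure_mono_null (fun x hx => lt_of_le_of_ne (hU0 x) (Ne.symm hx)) hz)
    obtain ⟨s, t, hst, hs, ht⟩ := LiebThirring.exists_lt_measure_inter_pos hA
    exact LiebThirring.orderedEigenvalue_opL_zero_lt hU hκ hst.le (h s t hst) hs ht
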